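/- Let $\Bbbk$ be a commutative unital ring and let $R$ be an associative unital $\Bbbk$-algebra; modules are left modules, and right $R$-modules are modules over the opposite ring $R^{\circ}$. Complexes are graded homologically; a complex $M$ is bounded above if $M_i=0$ for all $i\gg 0$. A complex $P$ of projective modules is semi-projective if $\mathrm{Hom}(P,-)$ preserves quasi-isomorphisms (equivalently, acyclicity). An acyclic complex $T$ of projective modules is totally acyclic if $\mathrm{Hom}(T,Q)$ is acyclic for every projective module $Q$. A complete projective resolution of a complex $M$ is a diagram $T \xrightarrow{\tau} P \xrightarrow{\pi} M$ of morphisms of complexes, where $P$ is semi-projective, $\pi$ is a quasi-isomorphism, $T$ is a totally acyclic complex of projective modules, and $\tau_i$ is an isomorphism for all $i\gg 0$. The Gorenstein projective dimension of $M$ is the infimum of the integers $n$ for which there is such a resolution with $\tau_i$ an isomorphism for all $i\ge n$; it is called finite (the value $-\infty$ included) if $M$ has a complete projective resolution. For an $R^{\circ}$-complex $M$ with complete projective resolution $T\to P\to M$ and an $R$-complex $N$, Tate homology is $\widehat{\mathrm{Tor}}{}^{R}_i(M,N)=H_i(T\otimes_R N)$, where $T\otimes_R N$ is the total tensor product complex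 formed with direct sums. Likewise, for an $R$-complex $N$ with complete projective resolution $T'\to P'\to N$ and an $R^{\circ}$-complex $M$, $\widehat{\mathrm{Tor}}{}^{R^{\circ}}_i(N,M)=H_i(T'\otimes_{R^{\circ}} M)$. Theorem (balancedness of Tate homology). Let $M$ be an $R^{\circ}$-complex and let $N$ be an $R$-complex, both bounded above and of finite Gorenstein projective dimension. Then, for every choice of complete projective resolutions of $M$ and of $N$ and for every $i\in\mathbb{Z}$, there is an isomorphism of $\Bbbk$-modules $$\widehat{\mathrm{Tor}}{}^{R}_i(M,N)\;\cong\;\widehat{\mathrm{Tor}}{}^{R^{\circ}}_i(N,M).$$ -/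

import Mathlib

open CategoryTheory Limits TensorProduct

universe u v t

noncomputable section

/-! ### Tensor products over a noncommutative ring

Right modules over `A` are left modules over the opposite ring of `A`. We fix a ring `B` together with an
identification `e : Aᵐᵒᵖ ≃ₐ[k] B`, so that a `B`-module is a right `A`-module: `a : A` acts on the
right of `x` as `e (op a) • x`. For `A = R` one takes `B = Rᵐᵒᵖ` and `e` the identity, and for
`A = Rᵐᵒᵖ` one takes `B = R` and `e` the canonical isomorphism `Rᵐᵒᵖᵐᵒᵖ ≃ R`. -/

namespace BalancedTensor

universe w

variable (k : Type*) [CommRing k] {A B : Type*} [Ring A] [Algebra k A] [Ring B] [Algebra k B]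

/-- A module over a `k`-algebra `A` is a `k`-module through the structure map `k → A`. -/
@[reducible] def baseModule (A : Type*) [Ring A] [Algebra k A] (X : ModuleCat.{w} A) :
    Module k X :=
  Module.compHom X (algebraMap k A)

attribute [local instance] baseModule

variable (e : Aᵐᵒᵖ ≃ₐ[k] B)

/-- The `k`-submodule of `X ⊗[k] Y` spanned by the elements `x a ⊗ y - x ⊗ a y`. -/
def relations (X : ModuleCat.{w} B) (Y : ModuleCat.{w} A) : Submodule k (X ⊗[k] Y) :=
  Submodule.span k {z | ∃ (x : X) (a : A) (y : Y),
    z = (e (MulOpposite.op a) • x) ⊗ₜ[k] y - x ⊗ₜ[k] (a • y)}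

/-- The map induced on underlying `k`-modules by an `A`-linear map. -/
def baseMap {A : Type*} [Ring A] [Algebra k A] {X X' : ModuleCat.{w} A} (f : X ⟶ X') :
    X →ₗ[k] X' where
  toFun := f.hom
  map_add' := f.hom.map_add
  map_smul' c x := f.hom.map_smul (algebraMap k A c) x

/-- The tensor product `X ⊗_A Y` of a right `A`-module `X` and a left `A`-module `Y`, as a
`k`-module. -/
def obj (X : ModuleCat.{w} B) (Y : ModuleCat.{w} A) : ModuleCat.{w} k :=
  ModuleCat.of k ((X ⊗[k] Y) ⧸ relations k e X Y)

lemma relations_le {X X' : ModuleCat.{w} B} {Y Y' : ModuleCat.{w} A} (f : X ⟶ X') (g : Y ⟶ Y') :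
    relations k e X Y ≤
      (relations k e X' Y').comap (TensorProduct.map (baseMap k f) (baseMap k g)) := by
  refine Submodule.span_le.2 ?_
  rintro _ ⟨x, a, y, rfl⟩
  refine Submodule.subset_span ⟨f.hom x, a, g.hom y, ?_⟩
  rw [map_sub, TensorProduct.map_tmul, TensorProduct.map_tmul]
  change (f.hom (e (MulOpposite.op a) • x)) ⊗ₜ[k] (g.hom y) - (f.hom x) ⊗ₜ[k] (g.hom (a • y)) = _
  rw [map_smul, map_smul]

/-- The map `f ⊗ g : X ⊗_A Y → X' ⊗_A Y'`, `x ⊗ y ↦ f x ⊗ g y`. -/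
def map {X X' : ModuleCat.{w} B} {Y Y' : ModuleCat.{w} A} (f : X ⟶ X') (g : Y ⟶ Y') :
    obj k e X Y ⟶ obj k e X' Y' :=
  ModuleCat.ofHom (Submodule.mapQ _ _ (TensorProduct.map (baseMap k f) (baseMap k g))
    (relations_le k e f g))

/-- The class of `x ⊗ y` in `X ⊗_A Y`. -/
def tmul {X : ModuleCat.{w} B} {Y : ModuleCat.{w} A} (x : X) (y : Y) : obj k e X Y :=
  Submodule.Quotient.mk (x ⊗ₜ[k] y)

lemma tmul_add {X : ModuleCat.{w} B} {Y : ModuleCat.{w} A} (x : X) (y y' : Y) :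
    tmul k e x (y + y') = tmul k e x y + tmul k e x y' :=
  congrArg Submodule.Quotient.mk (TensorProduct.tmul_add x y y')

lemma add_tmul {X : ModuleCat.{w} B} {Y : ModuleCat.{w} A} (x x' : X) (y : Y) :
    tmul k e (x + x') y = tmul k e x y + tmul k e x' y :=
  congrArg Submodule.Quotient.mk (TensorProduct.add_tmul x x' y)

variable {k e} in
lemma hom_ext {X : ModuleCat.{w} B} {Y : ModuleCat.{w} A} {Z : ModuleCat.{w} k}
    {p q : obj k e X Y ⟶ Z} (h : ∀ (x : X) (y : Y), p.hom (tmul k e x y) = q.hom (tmul k e x y)) :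
    p = q := by
  refine ModuleCat.hom_ext (Submodule.linearMap_qext _ (TensorProduct.ext' fun x y => h x y))

/-- The tensor product over `A` as a functor in two variables. -/
def functor : ModuleCat.{w} B ⥤ ModuleCat.{w} A ⥤ ModuleCat.{w} k where
  obj X :=
    { obj := fun Y => obj k e X Y
      map := fun g => map k e (𝟙 X) g
      map_id := fun _ => hom_ext fun _ _ => rfl
      map_comp := fun _ _ => hom_ext fun _ _ => rfl }
  map f :=
    { app := fun Y => map k e f (𝟙 Y)
      naturality := fun _ _ _ => hom_ext fun _ _ => rfl }
  map_id _ := NatTrans.ext (funext fun _ => hom_ext fun _ _ => rfl)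
  map_comp _ _ := NatTrans.ext (funext fun _ => hom_ext fun _ _ => rfl)

instance (X : ModuleCat.{w} B) : ((functor k e).obj X).Additive where
  map_add {_ _ f g} := hom_ext fun x y => tmul_add k e x (f.hom y) (g.hom y)

instance : (functor k e).Additive where
  map_add {_ _ f g} := NatTrans.ext (funext fun _ =>
    hom_ext fun x y => add_tmul k e (f.hom x) (g.hom x) y)

end BalancedTensor

/-! ### Complexes

Complexes are graded homologically. The module of a complex `M` in homological degree `i` is the
object of the cochain complex `M` in cohomological degree `-i`. -/

namespace TateHomology

universe w

/-- The complex `M` is bounded above: `M_i = 0` for all `i ≫ 0`. -/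
def BoundedAbove {A : Type*} [Ring A] (M : CochainComplex (ModuleCat.{w} A) ℤ) : Prop :=
  ∃ s : ℤ, ∀ i > s, IsZero (M.X (-i))

/-- The tensor product complex `X ⊗_A Y`: the total complex, with direct sums, of the modules
`X_i ⊗_A Y_j`, with differential `x ⊗ y ↦ dx ⊗ y + (-1)^|x| x ⊗ dy`. -/
def tensorComplex (k : Type*) [CommRing k] {A B : Type*} [Ring A] [Algebra k A] [Ring B]
    [Algebra k B] (e : Aᵐᵒᵖ ≃ₐ[k] B) (X : CochainComplex (ModuleCat.{w} B) ℤ)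
    (Y : CochainComplex (ModuleCat.{w} A) ℤ) : CochainComplex (ModuleCat.{w} k) ℤ :=
  HomologicalComplex.mapBifunctor X Y (BalancedTensor.functor k e) (ComplexShape.up ℤ)

variable {A : Type*} [Ring A]

/-- Semi-projective complexes: complexes of projective modules such that the functor `Hom(P, -)`
preserves acyclicity (equivalently, preserves quasi-isomorphisms). -/
structure IsSemiProjective (P : CochainComplex (ModuleCat.{w} A) ℤ) : Prop where
  projective (i : ℤ) : Module.Projective A (P.X i)
  acyclic_hom (Y : CochainComplex (ModuleCat.{w} A) ℤ) (hY : Y.Acyclic) :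
    (CochainComplex.HomComplex P Y).Acyclic

/-- Totally acyclic complexes of projective modules: acyclic complexes of projective modules such
that `Hom(T, Q)` is acyclic for every projective module `Q`. -/
structure IsTotallyAcyclic (T : CochainComplex (ModuleCat.{w} A) ℤ) : Prop where
  projective (i : ℤ) : Module.Projective A (T.X i)
  acyclic : T.Acyclic
  acyclic_hom (Q : ModuleCat.{w} A) (hQ : Module.Projective A Q) :
    (CochainComplex.HomComplex T
      ((HomologicalComplex.single (ModuleCat.{w} A) (ComplexShape.up ℤ) 0).obj Q)).Acyclic

/-- A complete projective resolution `T ⟶ P ⟶ M` of the complex `M`: `π : P ⟶ M` is a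
semi-projective resolution, `T` is a totally acyclic complex of projective modules, and
`τ_i : T_i ⟶ P_i` is an isomorphism for all `i ≫ 0`. -/
structure CompleteProjectiveResolution (M : CochainComplex (ModuleCat.{w} A) ℤ) where
  T : CochainComplex (ModuleCat.{w} A) ℤ
  P : CochainComplex (ModuleCat.{w} A) ℤ
  τ : T ⟶ P
  π : P ⟶ M
  totallyAcyclic : IsTotallyAcyclic T
  semiProjective : IsSemiProjective P
  quasiIso : QuasiIso π
  isIso_τ : ∃ n : ℤ, ∀ i ≥ n, IsIso (τ.f (-i))

/-- The Gorenstein projective dimension of `M`: the infimum of the integers `n` such that there is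
a complete projective resolution `T ⟶ P ⟶ M` with `τ_i` an isomorphism for all `i ≥ n`. It is less
than `⊤` exactly if `M` has a complete projective resolution. -/
def gorensteinProjectiveDimension (M : CochainComplex (ModuleCat.{w} A) ℤ) : EReal :=
  sInf {d | ∃ n : ℤ, d = ((n : ℝ) : EReal) ∧
    ∃ X : CompleteProjectiveResolution M, ∀ i ≥ n, IsIso (X.τ.f (-i))}

/-- Tate homology `H_i (T ⊗_A N)` of a complex `M` of right `A`-modules with coefficients in a
complex `N` of left `A`-modules, computed from the complete projective resolution
`T ⟶ P ⟶ M`. -/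
def tateTor (k : Type*) [CommRing k] {A B : Type*} [Ring A] [Algebra k A] [Ring B] [Algebra k B]
    (e : Aᵐᵒᵖ ≃ₐ[k] B) {M : CochainComplex (ModuleCat.{w} B) ℤ}
    (X : CompleteProjectiveResolution M) (N : CochainComplex (ModuleCat.{w} A) ℤ) (i : ℤ) :
    ModuleCat.{w} k :=
  (tensorComplex k e X.T N).homology (-i)

end TateHomology

end

/-! Let `T`, `T'` be the acyclic complexes in the resolutions of `M`, `N`, graded cohomologically,
and let `C^p`, `C'^q` be their opcycles (cokernels of the incoming differentials). Both Tate
homologies are expressed through `T` and `T'` alone, in a symmetric form.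

Reduction to a module. For `c` small, `N` vanishes below `c`, so it is quasi-isomorphic to the
truncation of its semi-projective resolution `P` at `c`. Tensoring with the projectives of `T`
respects quasi-isomorphisms of complexes that vanish in low degrees, so the truncation may replace
`N`. Its part above degree `c` becomes acyclic after tensoring with `T`: the complexes `T ⊗ P`
(`IsSemiProjective.acyclic_tensorComplex`) and `T ⊗ P^{≤ c}` are acyclic. What remains is the module
of opcycles of `P` in degree `c`, which is `C'^c` when `c` is small. Hence `H^n(T ⊗ N) ≅ H^{n-c}(T ⊗
C'^c)` (`exists_nonempty_homology_tensorComplex_iso`).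

Symmetry. Right exactness and flatness of `T^{p+1}` identify `H^p(T ⊗ C'^q)` with the kernel of `C^p
⊗ C'^q ⟶ T^{p+1} ⊗ T'^{q+1}` (`nonempty_homology_iso_kernel`), where the factors can be exchanged.
Dimension shifting (`nonempty_homology_tensorModule_iso`) shows that only the sum of the two indices
matters, which matches the truncation degrees chosen on the two sides. -/

noncomputable section

/-! ### Balanced tensor products: universal property, symmetry, exactness -/

namespace BalancedTensor

universe w

variable (k : Type*) [CommRing k] {A B : Type*} [Ring A] [Algebra k A] [Ring B] [Algebra k B]

attribute [local instance] baseModule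

variable (e : Aᵐᵒᵖ ≃ₐ[k] B)

lemma smul_tmul (X : ModuleCat.{w} B) (Y : ModuleCat.{w} A) (a : A) (x : X) (y : Y) :
    tmul k e (e (MulOpposite.op a) • x) y = tmul k e x (a • y) :=
  (Submodule.Quotient.eq _).2 (Submodule.subset_span ⟨x, a, y, rfl⟩)

/-- The class of `x ⊗ y`, as a biadditive map. -/
def tmulHom (X : ModuleCat.{w} B) (Y : ModuleCat.{w} A) : X →+ Y →+ obj k e X Y :=
  AddMonoidHom.mk' (fun x => AddMonoidHom.mk' (tmul k e x) (tmul_add k e x))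
    (fun x x' => AddMonoidHom.ext fun y => add_tmul k e x x' y)

@[simp]
lemma map_tmul {X X' : ModuleCat.{w} B} {Y Y' : ModuleCat.{w} A} (f : X ⟶ X') (g : Y ⟶ Y')
    (x : X) (y : Y) : (map k e f g).hom (tmul k e x y) = tmul k e (f.hom x) (g.hom y) := rfl

variable {k e} in
lemma obj_induction {X : ModuleCat.{w} B} {Y : ModuleCat.{w} A} {p : obj k e X Y → Prop}
    (z : obj k e X Y) (zero : p 0) (tmul : ∀ x y, p (tmul k e x y))
    (add : ∀ z z', p z → p z' → p (z + z')) : p z := by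
  obtain ⟨z, rfl⟩ := Submodule.Quotient.mk_surjective _ z
  induction z using TensorProduct.induction_on with
  | zero => exact zero
  | tmul x y => exact tmul x y
  | add z z' h h' => exact add _ _ h h'

variable {k e} in
lemma addHom_ext {X : ModuleCat.{w} B} {Y : ModuleCat.{w} A} {D : Type*} [AddCommGroup D]
    {p q : obj k e X Y →+ D} (h : ∀ x y, p (tmul k e x y) = q (tmul k e x y)) : p = q := by
  ext z
  induction z using obj_induction with
  | zero => simp
  | tmul x y => exact h x y
  | add z z' h h' => simp [h, h']

section lift

variable {k e} {X : ModuleCat.{w} B} {Y : ModuleCat.{w} A} {D : Type*} [AddCommGroup D]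
  (β : X →+ Y →+ D) (hβ : ∀ a x y, β (e (MulOpposite.op a) • x) y = β x (a • y))

-- Since `e` fixes the scalars from `k`, this is the balancing condition for `algebraMap k A c`. The
-- target is only an abelian group, so that `lift` also covers characters.
include hβ in
lemma balanced_base (c : k) (x : X) (y : Y) : β (c • x) y = β x (c • y) := by
  have h := hβ (algebraMap k A c) x y
  rwa [← MulOpposite.algebraMap_apply, AlgEquiv.commutes] at h

/-- The additive map out of `X ⊗_A Y` induced by a balanced biadditive map. -/
def lift : obj k e X Y →+ D :=
  QuotientAddGroup.lift (relations k e X Y).toAddSubgroup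
    (TensorProduct.liftAddHom β (balanced_base β hβ)) (by
      intro z hz
      refine Submodule.closure_induction (p := fun z _ =>
        TensorProduct.liftAddHom β (balanced_base β hβ) z = 0) (map_zero _)
        (fun z z' _ _ h h' => by rw [map_add, h, h', add_zero]) ?_ hz
      rintro c _ ⟨x, a, y, rfl⟩
      -- The target carries no `k`-action, so `c` is moved into the right factor, where it commutes
      -- with `a` because the image of `k` is central.
      rw [smul_sub, ← TensorProduct.tmul_smul, ← TensorProduct.tmul_smul, map_sub,
        TensorProduct.liftAddHom_tmul, TensorProduct.liftAddHom_tmul, hβ, sub_eq_zero]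
      congr 1
      change a • algebraMap k A c • y = algebraMap k A c • a • y
      rw [← mul_smul, ← mul_smul, Algebra.commutes])

end lift

section swap

variable (e' : Bᵐᵒᵖ ≃ₐ[k] A) (h : ∀ a : A, e' (MulOpposite.op (e (MulOpposite.op a))) = a)

include h in
lemma swap_aux (b : B) : e (MulOpposite.op (e' (MulOpposite.op b))) = b := by
  have := h (e' (MulOpposite.op b))
  simpa using this

/-- Exchanging the factors of a balanced tensor product. -/
def swapHom (h' : ∀ a : A, e' (MulOpposite.op (e (MulOpposite.op a))) = a)
    (X : ModuleCat.{w} B) (Y : ModuleCat.{w} A) : obj k e X Y ⟶ obj k e' Y X :=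
  ModuleCat.ofHom (Submodule.mapQ _ _ (TensorProduct.comm k X Y).toLinearMap (by
    refine Submodule.span_le.2 ?_
    rintro _ ⟨x, a, y, rfl⟩
    refine Submodule.mem_comap.2 ?_
    rw [map_sub, ← neg_sub]
    refine neg_mem (Submodule.subset_span ⟨y, e (MulOpposite.op a), x, ?_⟩)
    rw [h' a]
    rfl))

/-- The symmetry `X ⊗_A Y ≅ Y ⊗_B X` of the balanced tensor product. -/
def swap (X : ModuleCat.{w} B) (Y : ModuleCat.{w} A) : obj k e X Y ≅ obj k e' Y X where
  hom := swapHom k e e' h X Y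
  inv := swapHom k e' e (swap_aux k e e' h) Y X
  hom_inv_id := hom_ext fun _ _ => rfl
  inv_hom_id := hom_ext fun _ _ => rfl

/-- The symmetry of the balanced tensor product, as an isomorphism of functors. -/
def flipIso : (functor.{w} k e).flip ≅ functor k e' :=
  NatIso.ofComponents (fun Y => NatIso.ofComponents (fun X => swap k e e' h X Y)
    (fun _ => hom_ext fun _ _ => rfl))
    (fun _ => NatTrans.ext (funext fun _ => hom_ext fun _ _ => rfl))

end swap

/-- The isomorphism `Bᵐᵒᵖ ≃ₐ[k] A` obtained from `Aᵐᵒᵖ ≃ₐ[k] B`. -/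
def opEquiv : Bᵐᵒᵖ ≃ₐ[k] A := (AlgEquiv.op e.symm).trans (AlgEquiv.opOp k A).symm

lemma opEquiv_op (a : A) : opEquiv k e (MulOpposite.op (e (MulOpposite.op a))) = a := by
  simp [opEquiv]

section exactness

/-- A section `s` of the canonical surjection `(X →₀ B) ⟶ X` makes `X ⊗ Y` a retract of `X →₀ Y`,
naturally in `Y`, through `Φ` and `Ψ`. Exactness of `X →₀ S` is checked coordinatewise. -/
lemma exact_map_of_projective (X : ModuleCat.{w} B) [Module.Projective B X]
    {S : ShortComplex (ModuleCat.{w} A)} (hS : S.Exact) :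
    (S.map ((functor k e).obj X)).Exact := by
  classical
  obtain ⟨s, hs⟩ := Module.projective_def'.1 (inferInstance : Module.Projective B X)
  let act (Y : ModuleCat.{w} A) : B →+ Y →+ Y :=
    AddMonoidHom.mk' (fun b => AddMonoidHom.mk' (fun y => (e.symm b).unop • y) (smul_add _))
      (fun b b' => AddMonoidHom.ext fun y => by simp [add_smul])
  let Φ (Y : ModuleCat.{w} A) : obj k e X Y →+ (X →₀ Y) :=
    lift (AddMonoidHom.mk' (fun x => AddMonoidHom.mk'
        (fun y => Finsupp.mapRange.addMonoidHom ((act Y).flip y) (s x))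
        (fun y y' => by ext b; simp)) (fun x x' => by ext y b; simp)) (by
      intro a x y
      ext b
      simp [act, mul_smul])
  let Ψ (Y : ModuleCat.{w} A) : (X →₀ Y) →+ obj k e X Y :=
    Finsupp.liftAddHom (fun x => tmulHom k e X Y x)
  have hΨs (Y : ModuleCat.{w} A) (x : X) (y : Y) : Ψ Y (Finsupp.single x y) = tmul k e x y :=
    Finsupp.liftAddHom_apply_single (fun x => tmulHom k e X Y x) x y
  have hΨΦ (Y : ModuleCat.{w} A) (z : obj k e X Y) : Ψ Y (Φ Y z) = z := by
    refine DFunLike.congr_fun (addHom_ext (p := (Ψ Y).comp (Φ Y)) (q := AddMonoidHom.id _)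
      fun x y => ?_) z
    have hx : (s x).sum (fun b r => r • b) = x := DFunLike.congr_fun hs x
    change (Finsupp.mapRange _ (map_zero ((act Y).flip y)) (s x)).sum (fun b => tmulHom k e X Y b) = tmul k e x y
    rw [Finsupp.sum_mapRange_index (fun _ => map_zero _)]
    conv_rhs => rw [← hx]
    change _ = (tmulHom k e X Y).flip y _
    rw [Finsupp.sum, Finsupp.sum, map_sum]
    refine Finset.sum_congr rfl fun b _ => ?_
    change tmul k e b ((e.symm (s x b)).unop • y) = tmul k e (s x b • b) y
    rw [← smul_tmul, MulOpposite.op_unop, AlgEquiv.apply_symm_apply]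
  have hΦ {Y Y' : ModuleCat.{w} A} (g : Y ⟶ Y') (z : obj k e X Y) :
      Φ Y' ((map k e (𝟙 X) g).hom z) = Finsupp.mapRange.addMonoidHom g.hom.toAddMonoidHom (Φ Y z) := by
    refine DFunLike.congr_fun (addHom_ext
      (p := (Φ Y').comp (map k e (𝟙 X) g).hom.toAddMonoidHom)
      (q := (Finsupp.mapRange.addMonoidHom g.hom.toAddMonoidHom).comp (Φ Y)) fun x y => ?_) z
    ext b
    exact ((g.hom).map_smul _ _).symm
  have hΨ {Y Y' : ModuleCat.{w} A} (g : Y ⟶ Y') (z : X →₀ Y) :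
      Ψ Y' (Finsupp.mapRange.addMonoidHom g.hom.toAddMonoidHom z) =
        (map k e (𝟙 X) g).hom (Ψ Y z) := by
    refine DFunLike.congr_fun (f := (Ψ Y').comp
      (Finsupp.mapRange.addMonoidHom g.hom.toAddMonoidHom))
      (g := (map k e (𝟙 X) g).hom.toAddMonoidHom.comp (Ψ Y)) ?_ z
    refine Finsupp.addHom_ext fun x y => ?_
    change Ψ Y' (Finsupp.mapRange _ (map_zero g.hom.toAddMonoidHom) (Finsupp.single x y)) =
      (map k e (𝟙 X) g).hom (Ψ Y (Finsupp.single x y))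
    rw [Finsupp.mapRange_single, hΨs, hΨs]
    rfl
  rw [ShortComplex.moduleCat_exact_iff] at hS ⊢
  intro z hz
  change (map k e (𝟙 X) S.g).hom z = 0 at hz
  have h₁ (b : X) : ∃ y, S.f.hom y = Φ _ z b := by
    refine hS _ ?_
    have := hΦ S.g z
    rw [hz, map_zero] at this
    exact (DFunLike.congr_fun this b).symm
  choose y hy using h₁
  obtain ⟨w, hw⟩ : ∃ w, Finsupp.mapRange.addMonoidHom S.f.hom.toAddMonoidHom w = Φ _ z := by
    -- The chosen lifts of zero coordinates need not vanish; they are replaced by `0` to keep the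
    -- support finite.
    refine ⟨Finsupp.onFinset (Φ _ z).support (fun b => if Φ _ z b = 0 then 0 else y b)
      fun b hb => ?_, ?_⟩
    · rw [Finsupp.mem_support_iff]
      intro h
      simp [h] at hb
    · ext b
      change S.f.hom (if Φ _ z b = 0 then 0 else y b) = Φ _ z b
      split_ifs with hb
      · rw [map_zero, hb]
      · exact hy b
  refine ⟨Ψ _ w, ?_⟩
  exact (hΨ S.f w).symm.trans ((congrArg _ hw).trans (hΨΦ _ z))

instance (X : ModuleCat.{w} B) [Module.Projective B X] :
    ((functor k e).obj X).PreservesHomology :=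
  ((((functor k e).obj X).exact_tfae.out 1 2).1 fun _ => exact_map_of_projective k e X)

instance (Y : ModuleCat.{w} A) : ((functor.{w} k e).flip.obj Y).Additive where
  map_add {_ _ f g} := hom_ext fun x y => add_tmul k e (f.hom x) (g.hom x) y

lemma preservesHomology_flip (Y : ModuleCat.{w} A) [Module.Projective A Y] :
    ((functor.{w} k e).flip.obj Y).PreservesHomology := by
  refine ((((functor k e).flip.obj Y).exact_tfae.out 1 2).1 fun S hS => ?_)
  exact (ShortComplex.exact_iff_of_iso (S.mapNatIso
    ((flipIso k e (opEquiv k e) (opEquiv_op k e)).app Y))).2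
      (exact_map_of_projective k (opEquiv k e) Y hS)

/-- Right exactness of the balanced tensor product in the first variable. -/
lemma exact_map_flip_of_epi (Y : ModuleCat.{w} A) {S : ShortComplex (ModuleCat.{w} B)}
    (hS : S.Exact) [Epi S.g] : (S.map ((functor k e).flip.obj Y)).Exact := by
  have hg : Function.Surjective (baseMap k S.g) := (ModuleCat.epi_iff_surjective S.g).1 inferInstance
  have hex : Function.Exact (baseMap k S.f) (baseMap k S.g) :=
    (ShortComplex.ShortExact.moduleCat_exact_iff_function_exact S).1 hS
  rw [ShortComplex.moduleCat_exact_iff]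
  intro z hz
  obtain ⟨z, rfl⟩ := Submodule.Quotient.mk_surjective _ z
  replace hz : TensorProduct.map (baseMap k S.g) (baseMap k (𝟙 Y)) z ∈ relations k e S.X₃ Y :=
    (Submodule.Quotient.mk_eq_zero _).1 hz
  -- Since `S.g` is surjective, every relation lifts to a relation. Correcting `z` by such a lift
  -- reduces the claim to right exactness over `k`.
  have hle : relations k e S.X₃ Y ≤ (relations k e S.X₂ Y).map
      (TensorProduct.map (baseMap k S.g) (baseMap k (𝟙 Y))) := by
    refine Submodule.span_le.2 ?_
    rintro _ ⟨x, a, y, rfl⟩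
    obtain ⟨x, rfl⟩ := hg x
    refine ⟨_, Submodule.subset_span ⟨x, a, y, rfl⟩, ?_⟩
    rw [map_sub, TensorProduct.map_tmul, TensorProduct.map_tmul]
    change (S.g.hom (e (MulOpposite.op a) • x)) ⊗ₜ[k] y - _ = _
    rw [map_smul]
    rfl
  obtain ⟨r, hr, hrz⟩ := hle hz
  obtain ⟨t, ht⟩ := (rTensor_exact Y hex hg (z - r)).1 (by
    rw [map_sub, sub_eq_zero]
    exact hrz.symm)
  refine ⟨Submodule.Quotient.mk t, ?_⟩
  change Submodule.Quotient.mk (LinearMap.rTensor Y (baseMap k S.f) t) = _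
  rw [ht]
  refine (Submodule.Quotient.eq _).2 ?_
  simpa using hr

instance (Y : ModuleCat.{w} A) {X X' : ModuleCat.{w} B} (f : X ⟶ X') [Epi f] :
    Epi (((functor k e).flip.obj Y).map f) where
  left_cancellation p q h := hom_ext fun x y => by
    obtain ⟨x, rfl⟩ := (ModuleCat.epi_iff_surjective f).1 inferInstance x
    exact congr($h (tmul k e x y))

end exactness

end BalancedTensor

/-! ### Total complexes: differential, filtration, acyclicity criteria -/

namespace CochainComplex

section

variable {C₁ C₂ D : Type*} [Category* C₁] [Category* C₂] [Category* D]
  [HasZeroMorphisms C₁] [HasZeroMorphisms C₂] [Preadditive D]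
  (K₁ : CochainComplex C₁ ℤ) (K₂ : CochainComplex C₂ ℤ) (F : C₁ ⥤ C₂ ⥤ D)
  [F.PreservesZeroMorphisms] [∀ X₁, (F.obj X₁).PreservesZeroMorphisms]
  [HasMapBifunctor K₁ K₂ F]

lemma ιMapBifunctor_d {i i' j j' n n' : ℤ} (h : i + j = n) (hi : i + 1 = i') (hj : j + 1 = j')
    (hn : n + 1 = n') :
    ιMapBifunctor K₁ K₂ F i j n h ≫ (mapBifunctor K₁ K₂ F).d n n' =
      (F.map (K₁.d i i')).app (K₂.X j) ≫ ιMapBifunctor K₁ K₂ F i' j n' (by lia) +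
        i.negOnePow • ((F.obj (K₁.X i)).map (K₂.d j j') ≫
          ιMapBifunctor K₁ K₂ F i j' n' (by lia)) := by
  rw [HomologicalComplex.mapBifunctor.d_eq, Preadditive.comp_add,
    HomologicalComplex.mapBifunctor.ι_D₁, HomologicalComplex.mapBifunctor.ι_D₂,
    HomologicalComplex.mapBifunctor.d₁_eq K₁ K₂ F (ComplexShape.up ℤ) (i₁' := i') hi j n'
      (by change i' + j = n'; lia),
    HomologicalComplex.mapBifunctor.d₂_eq K₁ K₂ F (ComplexShape.up ℤ) i (i₂' := j') hj n'
      (by change i + j' = n'; lia)]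
  congr 1
  exact one_smul _ _

/-- The projection of the total complex of a bifunctor to a summand. -/
def πMapBifunctor (i j n : ℤ) (h : i + j = n) :
    (mapBifunctor K₁ K₂ F).X n ⟶ (F.obj (K₁.X i)).obj (K₂.X j) :=
  HomologicalComplex.mapBifunctorDesc (fun i' j' (h' : i' + j' = n) =>
    if hi : i' = i then
      (F.map (K₁.XIsoOfEq hi).hom).app (K₂.X j') ≫
        (F.obj (K₁.X i)).map (K₂.XIsoOfEq (show j' = j by lia)).hom
    else 0)

lemma ι_πMapBifunctor (i j n : ℤ) (h : i + j = n) :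
    ιMapBifunctor K₁ K₂ F i j n h ≫ πMapBifunctor K₁ K₂ F i j n h = 𝟙 _ := by
  simp [πMapBifunctor]

lemma ι_πMapBifunctor_of_ne (i j n : ℤ) (h : i + j = n) (i' j' : ℤ) (h' : i' + j' = n)
    (hi : i' ≠ i) :
    ιMapBifunctor K₁ K₂ F i' j' n h' ≫ πMapBifunctor K₁ K₂ F i j n h = 0 := by
  simp [πMapBifunctor, hi]

end

section

universe w

variable {C₁ C₂ : Type*} [Category* C₁] [Category* C₂] {k : Type*} [Ring k]
  [HasZeroMorphisms C₁] [HasZeroMorphisms C₂]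
  (K₁ : CochainComplex C₁ ℤ) (K₂ : CochainComplex C₂ ℤ) (F : C₁ ⥤ C₂ ⥤ ModuleCat.{w} k)
  [F.PreservesZeroMorphisms] [∀ X₁, (F.obj X₁).PreservesZeroMorphisms]
  [HasMapBifunctor K₁ K₂ F]

/-- The filtration of the total complex by the first degree. -/
def totalFiltration (n p : ℤ) : Submodule k ((mapBifunctor K₁ K₂ F).X n) :=
  ⨆ (i : ℤ) (j : ℤ) (h : i + j = n) (_ : p ≤ i), (ιMapBifunctor K₁ K₂ F i j n h).hom.range

lemma range_le_totalFiltration {n p i j : ℤ} (h : i + j = n) (hp : p ≤ i) :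
    (ιMapBifunctor K₁ K₂ F i j n h).hom.range ≤ totalFiltration K₁ K₂ F n p :=
  le_iSup_of_le i (le_iSup_of_le j (le_iSup_of_le h (le_iSup_of_le hp le_rfl)))

variable {K₁ K₂ F} in
lemma totalFiltration_le {n p : ℤ} {S : Submodule k ((mapBifunctor K₁ K₂ F).X n)}
    (hS : ∀ i j (h : i + j = n), p ≤ i → (ιMapBifunctor K₁ K₂ F i j n h).hom.range ≤ S) :
    totalFiltration K₁ K₂ F n p ≤ S :=
  iSup_le fun i => iSup_le fun j => iSup_le fun h => iSup_le fun hp => hS i j h hp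

lemma totalFiltration_antitone (n : ℤ) : Antitone (totalFiltration K₁ K₂ F n) :=
  fun _ _ hpq => totalFiltration_le fun _ _ h hi =>
    range_le_totalFiltration K₁ K₂ F h (hpq.trans hi)

/-- Total complexes are direct sums, so the filtration is exhaustive: the quotient map by the union
of its steps kills every summand. -/
lemma exists_mem_totalFiltration {n : ℤ} (z : (mapBifunctor K₁ K₂ F).X n) :
    ∃ p, z ∈ totalFiltration K₁ K₂ F n p := by
  have htop : (⨆ p, totalFiltration K₁ K₂ F n p) = ⊤ := by
    rw [← Submodule.ker_mkQ (⨆ p, totalFiltration K₁ K₂ F n p), LinearMap.ker_eq_top]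
    refine ModuleCat.hom_ext_iff.1 (show ModuleCat.ofHom
      (Submodule.mkQ (⨆ p, totalFiltration K₁ K₂ F n p)) = 0 from
        HomologicalComplex.mapBifunctor.hom_ext fun i j h => ?_)
    rw [comp_zero]
    ext x
    exact (Submodule.Quotient.mk_eq_zero _).2 ((le_iSup (totalFiltration K₁ K₂ F n) i)
      (range_le_totalFiltration K₁ K₂ F h le_rfl ⟨x, rfl⟩))
  exact (Submodule.mem_iSup_of_directed _ (totalFiltration_antitone K₁ K₂ F n).directed_le).1
    (htop ▸ Submodule.mem_top : z ∈ ⨆ p, totalFiltration K₁ K₂ F n p)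

/-- A total complex is acyclic if the bicomplex is exact in the second direction and if,
in each total degree, it vanishes when the first degree is large. -/
lemma acyclic_mapBifunctor
    (hK : ∀ i, (((F.obj (K₁.X i)).mapHomologicalComplex (ComplexShape.up ℤ)).obj K₂).Acyclic)
    (hb : ∀ n, ∃ b, ∀ i j, i + j = n → b < i → IsZero ((F.obj (K₁.X i)).obj (K₂.X j))) :
    (mapBifunctor K₁ K₂ F).Acyclic := by
  intro n
  rw [HomologicalComplex.exactAt_iff' _ (n - 1) n (n + 1) (by simp) (by simp),
    ShortComplex.moduleCat_exact_iff]
  intro z hz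
  obtain ⟨b, hb⟩ := hb n
  -- Induction on the distance `m` from the level `b + 1`, where the filtration is zero. The
  -- component `x` of lowest first degree `p` is a cycle for the second differential, hence a
  -- boundary; subtracting the total boundary of a preimage moves `z` one level up.
  have key (m : ℕ) (z : (mapBifunctor K₁ K₂ F).X n)
      (hz : ((mapBifunctor K₁ K₂ F).d n (n + 1)).hom z = 0)
      (hm : z ∈ totalFiltration K₁ K₂ F n (b + 1 - m)) :
      ∃ y, ((mapBifunctor K₁ K₂ F).d (n - 1) n).hom y = z := by
    induction m generalizing z with
    | zero =>
      have : totalFiltration K₁ K₂ F n (b + 1 - (0 : ℕ)) ≤ ⊥ := by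
        refine totalFiltration_le fun i j h hi => ?_
        rintro _ ⟨x, rfl⟩
        rw [(hb i j h (by push_cast at hi; lia)).eq_of_src (ιMapBifunctor K₁ K₂ F i j n h) 0]
        rfl
      obtain rfl : z = 0 := this hm
      exact ⟨0, map_zero _⟩
    | succ m ih =>
      obtain ⟨p, hp⟩ : ∃ p, p = b + 1 - ((m + 1 : ℕ) : ℤ) := ⟨_, rfl⟩
      obtain ⟨q, hq⟩ : ∃ q, p + q = n := ⟨n - p, by lia⟩
      rw [← hp] at hm
      have hp' : b + 1 - (m : ℤ) = p + 1 := by push_cast at hp; lia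
      rw [hp'] at ih
      have hsup : totalFiltration K₁ K₂ F n p ≤
          (ιMapBifunctor K₁ K₂ F p q n hq).hom.range ⊔ totalFiltration K₁ K₂ F n (p + 1) := by
        refine totalFiltration_le fun i j h hi => ?_
        obtain rfl | hi := hi.eq_or_lt
        · obtain rfl : j = q := by lia
          exact le_sup_left
        · exact (range_le_totalFiltration K₁ K₂ F h hi).trans le_sup_right
      obtain ⟨_, ⟨x, rfl⟩, z', hz', rfl⟩ := Submodule.mem_sup.1 (hsup hm)
      -- The differential never lowers the first degree, so the component of `d z` at `(p, q + 1)`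
      -- depends on `x` alone.
      have hker : totalFiltration K₁ K₂ F n (p + 1) ≤
          ((mapBifunctor K₁ K₂ F).d n (n + 1) ≫
            πMapBifunctor K₁ K₂ F p (q + 1) (n + 1) (by lia)).hom.ker := by
        refine totalFiltration_le fun i j h hi => ?_
        rintro _ ⟨y, rfl⟩
        have : ιMapBifunctor K₁ K₂ F i j n h ≫ (mapBifunctor K₁ K₂ F).d n (n + 1) ≫
            πMapBifunctor K₁ K₂ F p (q + 1) (n + 1) (by lia) = 0 := by
          rw [← Category.assoc, ιMapBifunctor_d K₁ K₂ F h rfl rfl rfl, Preadditive.add_comp,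
            Category.assoc, Linear.units_smul_comp, Category.assoc,
            ι_πMapBifunctor_of_ne _ _ _ _ _ _ _ _ _ _ (by lia),
            ι_πMapBifunctor_of_ne _ _ _ _ _ _ _ _ _ _ (by lia)]
          simp
        exact congr($this y)
      have hx : ((F.obj (K₁.X p)).map (K₂.d q (q + 1))).hom x = 0 := by
        have h₁ : ιMapBifunctor K₁ K₂ F p q n hq ≫ (mapBifunctor K₁ K₂ F).d n (n + 1) ≫
            πMapBifunctor K₁ K₂ F p (q + 1) (n + 1) (by lia) =
              p.negOnePow • (F.obj (K₁.X p)).map (K₂.d q (q + 1)) := by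
          rw [← Category.assoc, ιMapBifunctor_d K₁ K₂ F hq rfl rfl rfl, Preadditive.add_comp,
            Category.assoc, Linear.units_smul_comp, Category.assoc,
            ι_πMapBifunctor_of_ne _ _ _ _ _ _ _ _ _ _ (by lia), ι_πMapBifunctor]
          simp
        have h₂ : (πMapBifunctor K₁ K₂ F p (q + 1) (n + 1) (by lia)).hom
            (((mapBifunctor K₁ K₂ F).d n (n + 1)).hom
              ((ιMapBifunctor K₁ K₂ F p q n hq).hom x + z')) = 0 := by rw [hz, map_zero]
        rw [map_add, map_add, show (πMapBifunctor K₁ K₂ F p (q + 1) (n + 1) (by lia)).hom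
          (((mapBifunctor K₁ K₂ F).d n (n + 1)).hom z') = 0 from hker hz', add_zero] at h₂
        have h₃ : p.negOnePow • ((F.obj (K₁.X p)).map (K₂.d q (q + 1))).hom x = 0 :=
          (congr($h₁ x)).symm.trans h₂
        exact (smul_eq_zero_iff_eq _).1 h₃
      have hex := hK p q
      rw [HomologicalComplex.exactAt_iff' _ (q - 1) q (q + 1) (by simp) (by simp),
        ShortComplex.moduleCat_exact_iff] at hex
      obtain ⟨y, hy⟩ : ∃ y : (F.obj (K₁.X p)).obj (K₂.X (q - 1)),
        ((F.obj (K₁.X p)).map (K₂.d (q - 1) q)).hom y = x := hex x hx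
      -- The sign cancels the one on the second differential.
      set s : (mapBifunctor K₁ K₂ F).X (n - 1) :=
        p.negOnePow • (ιMapBifunctor K₁ K₂ F p (q - 1) (n - 1) (by lia)).hom y with hs
      have hds : ((mapBifunctor K₁ K₂ F).d (n - 1) n).hom s =
          (ιMapBifunctor K₁ K₂ F p q n hq).hom x + p.negOnePow •
            (ιMapBifunctor K₁ K₂ F (p + 1) (q - 1) n (by lia)).hom
              (((F.map (K₁.d p (p + 1))).app (K₂.X (q - 1))).hom y) := by
        have h₁ := congr($(ιMapBifunctor_d K₁ K₂ F (i := p) (j := q - 1) (n := n - 1) (n' := n)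
          (by lia) rfl (sub_add_cancel q 1) (by lia)) y)
        change ((mapBifunctor K₁ K₂ F).d (n - 1) n).hom
          ((ιMapBifunctor K₁ K₂ F p (q - 1) (n - 1) (by lia)).hom y) =
            (ιMapBifunctor K₁ K₂ F (p + 1) (q - 1) n (by lia)).hom
              (((F.map (K₁.d p (p + 1))).app (K₂.X (q - 1))).hom y) + p.negOnePow •
            (ιMapBifunctor K₁ K₂ F p q n hq).hom
              (((F.obj (K₁.X p)).map (K₂.d (q - 1) q)).hom y) at h₁
        rw [hy] at h₁
        rw [hs, Units.smul_def, map_zsmul, ← Units.smul_def, h₁, smul_add, smul_smul,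
          Int.units_mul_self, one_smul, add_comm]
      have hzs : ((mapBifunctor K₁ K₂ F).d n (n + 1)).hom
          ((ιMapBifunctor K₁ K₂ F p q n hq).hom x + z' -
            ((mapBifunctor K₁ K₂ F).d (n - 1) n).hom s) = 0 := by
        rw [map_sub, hz, show ((mapBifunctor K₁ K₂ F).d n (n + 1)).hom
          (((mapBifunctor K₁ K₂ F).d (n - 1) n).hom s) = 0 from
            congr($((mapBifunctor K₁ K₂ F).d_comp_d (n - 1) n (n + 1)) s), sub_zero]
      obtain ⟨t, ht⟩ := ih _ hzs (by
        rw [hds, add_sub_add_left_eq_sub]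
        refine sub_mem hz' ?_
        rw [Units.smul_def]
        exact zsmul_mem (range_le_totalFiltration K₁ K₂ F (i := p + 1) (j := q - 1) (by lia)
          le_rfl ⟨_, rfl⟩) _)
      exact ⟨t + s, by rw [map_add, ht, sub_add_cancel]⟩
  obtain ⟨p, hp⟩ := exists_mem_totalFiltration K₁ K₂ F z
  -- If `p > b + 1`, `toNat` gives `0`, and antitonicity still places `z` in level `b + 1`.
  exact key (b + 1 - p).toNat z hz (totalFiltration_antitone K₁ K₂ F n (by lia) hp)

/-- A total complex is acyclic if the bicomplex is exact in the first direction and if,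
in each total degree, it vanishes when the second degree is large. -/
lemma acyclic_mapBifunctor_of_flip
    (hK : ∀ j, (((F.flip.obj (K₂.X j)).mapHomologicalComplex (ComplexShape.up ℤ)).obj K₁).Acyclic)
    (hb : ∀ n, ∃ b, ∀ i j, i + j = n → b < j → IsZero ((F.obj (K₁.X i)).obj (K₂.X j))) :
    (mapBifunctor K₁ K₂ F).Acyclic := by
  have := acyclic_mapBifunctor K₂ K₁ F.flip hK fun n => by
    obtain ⟨b, hb⟩ := hb n
    exact ⟨b, fun i j h hi => hb j i (by lia) hi⟩
  exact fun n => (this n).of_iso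
    (HomologicalComplex.mapBifunctorFlipIso K₁ K₂ F (ComplexShape.up ℤ))

end

end CochainComplex

/-! ### Total complexes as functors of the second complex; mapping cones -/

namespace CochainComplex

section

variable {C₁ C₂ D : Type*} [Category* C₁] [Category* C₂] [Category* D]
  [HasZeroMorphisms C₁] [Preadditive C₂] [Preadditive D]
  (K : CochainComplex C₁ ℤ) (F : C₁ ⥤ C₂ ⥤ D)
  [F.PreservesZeroMorphisms] [∀ X₁, (F.obj X₁).Additive]
  [∀ (K₁ : CochainComplex C₁ ℤ) (K₂ : CochainComplex C₂ ℤ), HasMapBifunctor K₁ K₂ F]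

/-- The map induced on a component of the total complex by maps of the components of
the second complex. -/
def mapBifunctorGradedMap {Y Z : CochainComplex C₂ ℤ} (f : ∀ j, Y.X j ⟶ Z.X j) (n : ℤ) :
    (mapBifunctor K Y F).X n ⟶ (mapBifunctor K Z F).X n :=
  HomologicalComplex.mapBifunctorDesc (fun i j h =>
    (F.obj (K.X i)).map (f j) ≫ ιMapBifunctor K Z F i j n h)

/-- Degreewise splittings need not commute with differentials, so functoriality is needed for mere
families of maps. -/
lemma mapBifunctorGradedMap_comp {X Y Z : CochainComplex C₂ ℤ} (f : ∀ j, X.X j ⟶ Y.X j)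
    (g : ∀ j, Y.X j ⟶ Z.X j) (n : ℤ) :
    mapBifunctorGradedMap K F f n ≫ mapBifunctorGradedMap K F g n =
      mapBifunctorGradedMap K F (fun j => f j ≫ g j) n :=
  HomologicalComplex.mapBifunctor.hom_ext fun i j h => by simp [mapBifunctorGradedMap]

lemma mapBifunctorGradedMap_add {X Y : CochainComplex C₂ ℤ} (f g : ∀ j, X.X j ⟶ Y.X j) (n : ℤ) :
    mapBifunctorGradedMap K F f n + mapBifunctorGradedMap K F g n =
      mapBifunctorGradedMap K F (fun j => f j + g j) n :=
  HomologicalComplex.mapBifunctor.hom_ext fun i j h => by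
    simp [mapBifunctorGradedMap, Functor.map_add]

lemma mapBifunctorGradedMap_id (X : CochainComplex C₂ ℤ) (n : ℤ) :
    mapBifunctorGradedMap K F (fun j => 𝟙 (X.X j)) n = 𝟙 _ :=
  HomologicalComplex.mapBifunctor.hom_ext fun i j h => by simp [mapBifunctorGradedMap]

lemma map₂CochainComplex_map_f {X Y : CochainComplex C₂ ℤ} (f : X ⟶ Y) (n : ℤ) :
    ((F.map₂CochainComplex.obj K).map f).f n = mapBifunctorGradedMap K F f.f n :=
  HomologicalComplex.mapBifunctor.hom_ext fun i j h => by
    refine (HomologicalComplex.ι_mapBifunctorMap (𝟙 K) f F (ComplexShape.up ℤ) i j n h).trans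
      (Eq.trans ?_ (HomologicalComplex.ι_mapBifunctorDesc (K₁ := K) (K₂ := X) (F := F)
        (fun i j h => (F.obj (K.X i)).map (f.f j) ≫ ιMapBifunctor K Y F i j n h) i j h).symm)
    simp

instance : (F.map₂CochainComplex.obj K).Additive where
  map_add {X Y f g} := by
    ext n : 1
    exact (map₂CochainComplex_map_f K F (f + g) n).trans
      ((mapBifunctorGradedMap_add K F f.f g.f n).symm.trans
        (congrArg₂ _ (map₂CochainComplex_map_f K F f n).symm
          (map₂CochainComplex_map_f K F g n).symm))

/-- A degreewise splitting of a short complex of complexes induces one of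
the total complexes. -/
def mapBifunctorSplitting {S : ShortComplex (CochainComplex C₂ ℤ)}
    (σ : ∀ j, (S.map (HomologicalComplex.eval _ _ j)).Splitting) (n : ℤ) :
    ((S.map (F.map₂CochainComplex.obj K)).map (HomologicalComplex.eval _ _ n)).Splitting :=
  let r (j : ℤ) : S.X₂.X j ⟶ S.X₁.X j := (σ j).r
  let s (j : ℤ) : S.X₃.X j ⟶ S.X₂.X j := (σ j).s
  have hr : mapBifunctorGradedMap K F S.f.f n ≫ mapBifunctorGradedMap K F r n = 𝟙 _ := by
    rw [mapBifunctorGradedMap_comp, ← mapBifunctorGradedMap_id]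
    exact congrArg (fun f => mapBifunctorGradedMap K F f n) (funext fun j => (σ j).f_r)
  have hs : mapBifunctorGradedMap K F s n ≫ mapBifunctorGradedMap K F S.g.f n = 𝟙 _ := by
    rw [mapBifunctorGradedMap_comp, ← mapBifunctorGradedMap_id]
    exact congrArg (fun f => mapBifunctorGradedMap K F f n) (funext fun j => (σ j).s_g)
  have hid : mapBifunctorGradedMap K F r n ≫ mapBifunctorGradedMap K F S.f.f n +
      mapBifunctorGradedMap K F S.g.f n ≫ mapBifunctorGradedMap K F s n = 𝟙 _ := by
    rw [mapBifunctorGradedMap_comp, mapBifunctorGradedMap_comp, mapBifunctorGradedMap_add,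
      ← mapBifunctorGradedMap_id]
    exact congrArg (fun f => mapBifunctorGradedMap K F f n) (funext fun j => (σ j).id)
  { r := mapBifunctorGradedMap K F r n
    s := mapBifunctorGradedMap K F s n
    f_r := (congrArg (· ≫ mapBifunctorGradedMap K F r n)
      (map₂CochainComplex_map_f K F S.f n)).trans hr
    s_g := (congrArg (mapBifunctorGradedMap K F s n ≫ ·)
      (map₂CochainComplex_map_f K F S.g n)).trans hs
    id := (congrArg₂ (fun (f : (mapBifunctor K S.X₁ F).X n ⟶ (mapBifunctor K S.X₂ F).X n)
      (g : (mapBifunctor K S.X₂ F).X n ⟶ (mapBifunctor K S.X₃ F).X n) => mapBifunctorGradedMap K F r n ≫ f +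
      g ≫ mapBifunctorGradedMap K F s n) (map₂CochainComplex_map_f K F S.f n)
      (map₂CochainComplex_map_f K F S.g n)).trans hid }

/-- The summand of a total complex, when the second complex is concentrated in one degree. -/
def ιMapBifunctorIso {W : CochainComplex C₂ ℤ} {c : ℤ} (hW : ∀ j ≠ c, IsZero (W.X j))
    (i n : ℤ) (h : i + c = n) : (F.obj (K.X i)).obj (W.X c) ≅ (mapBifunctor K W F).X n where
  hom := ιMapBifunctor K W F i c n h
  inv := πMapBifunctor K W F i c n h
  hom_inv_id := ι_πMapBifunctor K W F i c n h
  inv_hom_id := HomologicalComplex.mapBifunctor.hom_ext fun i' j (h' : i' + j = n) => by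
    by_cases hj : j = c
    · obtain rfl := hj
      obtain rfl : i' = i := by lia
      erw [← Category.assoc, ι_πMapBifunctor]
      rw [Category.id_comp, Category.comp_id]
    · exact ((F.obj (K.X i')).map_isZero (hW j hj)).eq_of_src _ _

instance (G : C₂) : (F.flip.obj G).PreservesZeroMorphisms where
  map_zero _ _ := by simp

/-- The homology of the total complex, when the second complex is concentrated in one degree. -/
lemma nonempty_mapBifunctor_homology_iso [CategoryWithHomology D] {W : CochainComplex C₂ ℤ} {c : ℤ}
    (hW : ∀ j ≠ c, IsZero (W.X j)) (i n : ℤ) (h : i + c = n) :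
    Nonempty ((mapBifunctor K W F).homology n ≅
      (((F.flip.obj (W.X c)).mapHomologicalComplex _).obj K).homology i) := by
  have hd (i i' n n' : ℤ) (h : i + c = n) (h' : i' + c = n') (hi : i + 1 = i') :
      (F.map (K.d i i')).app (W.X c) ≫ (ιMapBifunctorIso K F hW i' n' h').hom =
        (ιMapBifunctorIso K F hW i n h).hom ≫ (mapBifunctor K W F).d n n' := by
    change _ ≫ ιMapBifunctor K W F i' c n' h' = ιMapBifunctor K W F i c n h ≫ _
    rw [ιMapBifunctor_d K W F h hi rfl (by lia),
      (hW (c + 1) (by lia)).eq_of_tgt (W.d c (c + 1)) 0]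
    simp
  refine ⟨ShortComplex.homologyMapIso (?_ : (mapBifunctor K W F).sc n ≅
    (((F.flip.obj (W.X c)).mapHomologicalComplex _).obj K).sc i)⟩
  refine (mapBifunctor K W F).isoSc' (n - 1) n (n + 1) (by simp) (by simp) ≪≫
    (ShortComplex.isoMk (ιMapBifunctorIso K F hW (i - 1) (n - 1) (by lia))
      (ιMapBifunctorIso K F hW i n h) (ιMapBifunctorIso K F hW (i + 1) (n + 1) (by lia))
      (hd _ _ _ _ _ _ (by lia)).symm (hd _ _ _ _ _ _ rfl).symm).symm ≪≫
    ((((F.flip.obj (W.X c)).mapHomologicalComplex _).obj K).isoSc' (i - 1) i (i + 1)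
      (by simp) (by simp)).symm

end

section

variable {C₁ C₂ D : Type*} [Category* C₁] [Category* C₂] [Category* D]
  [HasZeroMorphisms C₁] [Preadditive C₂] [Abelian D]
  (K : CochainComplex C₁ ℤ) (F : C₁ ⥤ C₂ ⥤ D)
  [F.PreservesZeroMorphisms] [∀ X₁, (F.obj X₁).Additive]
  [∀ (K₁ : CochainComplex C₁ ℤ) (K₂ : CochainComplex C₂ ℤ), HasMapBifunctor K₁ K₂ F]

/-- Additive functors and direct sums preserve split sequences, so no exactness of `F` is required.
-/
lemma shortExact_map₂CochainComplex {S : ShortComplex (CochainComplex C₂ ℤ)}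
    (σ : ∀ j, (S.map (HomologicalComplex.eval _ _ j)).Splitting) :
    (S.map (F.map₂CochainComplex.obj K)).ShortExact :=
  HomologicalComplex.shortExact_of_degreewise_shortExact _
    fun n => (mapBifunctorSplitting K F σ n).shortExact

end

section

variable {C : Type*} [Category* C] [Abelian C] {S : ShortComplex (CochainComplex C ℤ)}

lemma nonempty_homology_iso_of_acyclic_X₁ (hS : S.ShortExact) (h : S.X₁.Acyclic) (i : ℤ) :
    Nonempty (S.X₂.homology i ≅ S.X₃.homology i) := by
  have := (hS.homology_exact₂ i).mono_g ((h i).isZero_homology.eq_of_src _ _)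
  have := (hS.homology_exact₃ i (i + 1) rfl).epi_f ((h (i + 1)).isZero_homology.eq_of_tgt _ _)
  exact ⟨@asIso _ _ _ _ (HomologicalComplex.homologyMap S.g i) (isIso_of_mono_of_epi _)⟩

lemma nonempty_homology_iso_of_acyclic_X₂ (hS : S.ShortExact) (h : S.X₂.Acyclic) (i j : ℤ)
    (hij : i + 1 = j) : Nonempty (S.X₃.homology i ≅ S.X₁.homology j) :=
  ⟨hS.δIso i j hij (h i).isZero_homology (h j).isZero_homology⟩

lemma acyclic_X₁_of_shortExact (hS : S.ShortExact) (h₂ : S.X₂.Acyclic) (h₃ : S.X₃.Acyclic) :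
    S.X₁.Acyclic := by
  refine hS.acyclic_X₁ ⟨fun i => ?_⟩
  rw [quasiIsoAt_iff_exactAt' _ _ (h₃ i)]
  exact h₂ i

end

section

variable {C : Type*} [Category* C] [Abelian C]

lemma acyclic_mappingCone {K L : CochainComplex C ℤ} (f : K ⟶ L) [hf : QuasiIso f] :
    (mappingCone f).Acyclic := by
  rw [← HomotopyCategory.quotient_obj_mem_subcategoryAcyclic_iff_acyclic]
  refine ((HomotopyCategory.subcategoryAcyclic C).trW_iff_of_distinguished _
    (HomotopyCategory.mappingCone_triangleh_distinguished f)).1 ?_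
  rw [← HomotopyCategory.quasiIso_eq_trW_subcategoryAcyclic]
  exact (HomotopyCategory.quotient_map_mem_quasiIso_iff f).2 hf

/-- The short complex `L ⟶ mappingCone f ⟶ K⟦1⟧`. -/
def mappingConeShortComplex {K L : CochainComplex C ℤ} (f : K ⟶ L) :
    ShortComplex (CochainComplex C ℤ) :=
  ShortComplex.mk (mappingCone.inr f) (mappingCone.triangle f).mor₃
    (mappingCone.inr_triangleδ f)

/-- The degreewise splitting of the sequence `L ⟶ mappingCone f ⟶ K⟦1⟧`. -/
def mappingConeSplitting {K L : CochainComplex C ℤ} (f : K ⟶ L) (j : ℤ) :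
    ((mappingConeShortComplex f).map (HomologicalComplex.eval _ _ j)).Splitting :=
  let t : (mappingCone f).X j ⟶ K.X (j + 1) := (mappingCone.triangle f).mor₃.f j
  -- The third map of the triangle is minus the projection; hence the sign in the section below.
  have hs : (mappingCone.inl f).v (j + 1) j (by lia) ≫ t = -𝟙 (K.X (j + 1)) := by
    refine (mappingCone.inl_v_triangle_mor₃_f f (j + 1) j (by lia)).trans ?_
    simp [shiftFunctorObjXIso, HomologicalComplex.XIsoOfEq]
    rfl
  have ht : (mappingCone.inr f).f j ≫ t = 0 := mappingCone.inr_f_triangle_mor₃_f f j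
  have hid : (mappingCone.snd f).v j j (add_zero j) ≫ (mappingCone.inr f).f j +
      t ≫ (-(mappingCone.inl f).v (j + 1) j (by lia)) = 𝟙 _ := by
    refine mappingCone.ext_from f (j + 1) j rfl ?_ ?_
    · rw [Preadditive.comp_add, mappingCone.inl_v_snd_v_assoc, zero_comp, zero_add,
        Category.comp_id, ← Category.assoc, hs]
      simp
    · rw [Preadditive.comp_add, mappingCone.inr_f_snd_v_assoc, ← Category.assoc, ht, zero_comp,
        add_zero, Category.comp_id]
  { r := (mappingCone.snd f).v j j (add_zero j)
    s := -(mappingCone.inl f).v (j + 1) j (by lia)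
    f_r := mappingCone.inr_f_snd_v f j
    s_g := (Preadditive.neg_comp _ _).trans ((congrArg _ hs).trans (neg_neg _))
    id := hid }

end

end CochainComplex

/-! ### Additive maps out of a total complex -/

namespace CochainComplex

universe w

variable {C₁ C₂ : Type*} [Category* C₁] [Category* C₂] {k : Type*} [Ring k]
  [HasZeroMorphisms C₁] [HasZeroMorphisms C₂]
  (K₁ : CochainComplex C₁ ℤ) (K₂ : CochainComplex C₂ ℤ) (F : C₁ ⥤ C₂ ⥤ ModuleCat.{w} k)
  [F.PreservesZeroMorphisms] [∀ X₁, (F.obj X₁).PreservesZeroMorphisms]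
  [HasMapBifunctor K₁ K₂ F]

variable {K₁ K₂ F} in
lemma mapBifunctor_induction {n : ℤ} {p : (mapBifunctor K₁ K₂ F).X n → Prop}
    (z : (mapBifunctor K₁ K₂ F).X n) (zero : p 0) (add : ∀ z z', p z → p z' → p (z + z'))
    (ι : ∀ i j (h : i + j = n) x, p ((ιMapBifunctor K₁ K₂ F i j n h).hom x)) : p z := by
  -- Since `p` is not assumed stable under scalars, the submodule consists of the elements all of
  -- whose multiples satisfy `p`.
  let S : Submodule k ((mapBifunctor K₁ K₂ F).X n) :=
    { carrier := { z | ∀ c : k, p (c • z) }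
      zero_mem' := fun c => by rwa [smul_zero]
      add_mem' := fun h h' c => by rw [smul_add]; exact add _ _ (h c) (h' c)
      smul_mem' := fun c z h c' => by rw [smul_smul]; exact h _ }
  obtain ⟨q, hq⟩ := exists_mem_totalFiltration K₁ K₂ F z
  have hS : totalFiltration K₁ K₂ F n q ≤ S := totalFiltration_le fun i j h _ => by
    rintro _ ⟨x, rfl⟩ c
    rw [← map_smul]
    exact ι i j h _
  simpa using hS hq 1

/-- The universal property of the total complex only yields `k`-linear maps. Mapping first to a
`DirectSum` gives access to targets that are just abelian groups, such as the group of values of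
characters. -/
lemma exists_addMonoidHom_mapBifunctor {D : Type*} [AddCommGroup D] (n : ℤ)
    (g : ∀ i j, i + j = n → ((F.obj (K₁.X i)).obj (K₂.X j) →+ D)) :
    ∃ ψ : (mapBifunctor K₁ K₂ F).X n →+ D,
      ∀ i j (h : i + j = n) x, ψ ((ιMapBifunctor K₁ K₂ F i j n h).hom x) = g i j h x := by
  let φ : (mapBifunctor K₁ K₂ F).X n ⟶
      ModuleCat.of k (DirectSum ℤ fun i => (F.obj (K₁.X i)).obj (K₂.X (n - i))) :=
    HomologicalComplex.mapBifunctorDesc fun i j (h : i + j = n) =>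
      (F.obj (K₁.X i)).map (K₂.XIsoOfEq (show j = n - i by lia)).hom ≫
        ModuleCat.ofHom (DirectSum.lof k ℤ (fun i => (F.obj (K₁.X i)).obj (K₂.X (n - i))) i)
  let θ : (DirectSum ℤ fun i => (F.obj (K₁.X i)).obj (K₂.X (n - i))) →+ D :=
    DirectSum.toAddMonoid fun i => g i (n - i) (by lia)
  refine ⟨θ.comp φ.hom.toAddMonoidHom, fun i j h x => ?_⟩
  obtain rfl : j = n - i := by lia
  have hφ : ιMapBifunctor K₁ K₂ F i (n - i) n h ≫ φ =
      ModuleCat.ofHom (DirectSum.lof k ℤ (fun i => (F.obj (K₁.X i)).obj (K₂.X (n - i))) i) := by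
    refine (HomologicalComplex.ι_mapBifunctorDesc _ _ _ _).trans ?_
    simp
  have hx : φ.hom ((ιMapBifunctor K₁ K₂ F i (n - i) n h).hom x) =
      DirectSum.of (fun i => (F.obj (K₁.X i)).obj (K₂.X (n - i))) i x := congr($hφ x)
  exact (congrArg θ hx).trans (DirectSum.toAddMonoid_of (fun i => g i (n - i) (by lia)) i x)

/-- Reindexed to match the character complex, whose degree `q` comes from degree `-q`. -/
lemma exists_addMonoidHom_mapBifunctor_neg {D : Type*} [AddCommGroup D] (n : ℤ)
    (g : ∀ i j, -i + j = n → ((F.obj (K₁.X (-i))).obj (K₂.X j) →+ D)) :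
    ∃ ψ : (mapBifunctor K₁ K₂ F).X n →+ D,
      ∀ i j (h : -i + j = n) x, ψ ((ιMapBifunctor K₁ K₂ F (-i) j n h).hom x) = g i j h x := by
  have (i j : ℤ) (h : i + j = n) : ∃ f : (F.obj (K₁.X i)).obj (K₂.X j) →+ D,
      ∀ i' (hi : -i' = i), f = hi ▸ g i' j (hi ▸ h) := by
    obtain ⟨i, rfl⟩ : ∃ i', i = -i' := ⟨-i, by lia⟩
    refine ⟨g i j h, fun i' hi => ?_⟩
    obtain rfl : i' = i := by lia
    rfl
  choose f hf using this
  obtain ⟨ψ, hψ⟩ := exists_addMonoidHom_mapBifunctor K₁ K₂ F n f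
  exact ⟨ψ, fun i j h x => (hψ (-i) j h x).trans (congr($(hf (-i) j h i rfl) x))⟩

end CochainComplex

/-! ### Character duality -/

namespace BalancedTensor

universe w

variable (k : Type*) [CommRing k] {A B : Type*} [Ring A] [Algebra k A] [Ring B] [Algebra k B]

attribute [local instance] baseModule

variable (e : Aᵐᵒᵖ ≃ₐ[k] B)

/-- The group of characters of a right `A`-module. -/
@[nolint unusedArguments]
def Character (_ : Aᵐᵒᵖ ≃ₐ[k] B) (X : ModuleCat.{w} B) : Type w := X →+ AddCircle (1 : ℚ)

instance (X : ModuleCat.{w} B) : AddCommGroup (Character k e X) :=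
  inferInstanceAs (AddCommGroup (X →+ AddCircle (1 : ℚ)))

instance (X : ModuleCat.{w} B) : FunLike (Character k e X) X (AddCircle (1 : ℚ)) :=
  inferInstanceAs (FunLike (X →+ AddCircle (1 : ℚ)) _ _)

instance (X : ModuleCat.{w} B) : AddMonoidHomClass (Character k e X) X (AddCircle (1 : ℚ)) :=
  inferInstanceAs (AddMonoidHomClass (X →+ AddCircle (1 : ℚ)) _ _)

variable {k e} in
@[ext]
lemma Character.ext {X : ModuleCat.{w} B} {φ ψ : Character k e X} (h : ∀ x, φ x = ψ x) : φ = ψ :=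
  DFunLike.ext _ _ h

/-- The group of characters of a right `A`-module is a left `A`-module. -/
instance (X : ModuleCat.{w} B) : Module A (Character k e X) where
  smul a φ := AddMonoidHom.comp φ (DistribSMul.toAddMonoidHom X (e (MulOpposite.op a)))
  one_smul φ := Character.ext fun x => congrArg φ (by simp)
  mul_smul a b φ := Character.ext fun x => congrArg φ (by simp [mul_smul])
  smul_zero a := rfl
  smul_add a φ ψ := rfl
  add_smul a b φ := Character.ext fun x =>
    (congrArg φ (by simp [add_smul])).trans (map_add φ _ _)
  zero_smul φ := Character.ext fun x => (congrArg φ (by simp)).trans (map_zero φ)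

/-- The map on characters induced by a map of right `A`-modules. -/
def characterMap {X X' : ModuleCat.{w} B} (f : X ⟶ X') :
    ModuleCat.of A (Character k e X') ⟶ ModuleCat.of A (Character k e X) :=
  ModuleCat.ofHom
    { toFun := fun φ => AddMonoidHom.comp φ f.hom.toAddMonoidHom
      map_add' := fun _ _ => rfl
      map_smul' := fun _ φ => Character.ext fun x => congrArg φ (f.hom.map_smul _ x).symm }

/-- By exactness `φ` factors through the quotient by the kernel of `S.g`, which embeds in `S.X₃`;
the resulting character extends because `ℚ/ℤ` is injective. -/
lemma exists_character_comp {S : ShortComplex (ModuleCat.{w} B)} (hS : S.Exact)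
    (φ : Character k e S.X₂) (hφ : ∀ x, φ (S.f.hom x) = 0) :
    ∃ ψ : Character k e S.X₃, ∀ x, φ x = ψ (S.g.hom x) := by
  let g : S.X₂ →+ S.X₃ := S.g.hom.toAddMonoidHom
  rw [ShortComplex.moduleCat_exact_iff] at hS
  let φ' : S.X₂ ⧸ g.ker →+ AddCircle (1 : ℚ) := QuotientAddGroup.lift g.ker φ (by
    intro x hx
    obtain ⟨y, rfl⟩ := hS x hx
    exact hφ y)
  obtain ⟨ψ, hψ⟩ := CharacterModule.dual_surjective_of_injective (R := ℤ)
    (QuotientAddGroup.kerLift g).toIntLinearMap (QuotientAddGroup.kerLift_injective g) φ'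
  exact ⟨ψ, fun x => (DFunLike.congr_fun hψ (QuotientAddGroup.mk x)).symm⟩

variable {k e} in
lemma hom_character_ext {X : ModuleCat.{w} B} {Y : ModuleCat.{w} A}
    {α β : Y ⟶ ModuleCat.of A (Character k e X)}
    (h : ∀ (y : Y) (x : X), (α.hom y : Character k e X) x = (β.hom y : Character k e X) x) :
    α = β :=
  ModuleCat.hom_ext (LinearMap.ext fun y => Character.ext (h y))

/-- A character of `X ⊗_A Y` as a map from `Y` to the characters of `X`. -/
def curry {X : ModuleCat.{w} B} {Y : ModuleCat.{w} A} (χ : obj k e X Y →+ AddCircle (1 : ℚ)) :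
    Y ⟶ ModuleCat.of A (Character k e X) :=
  ModuleCat.ofHom
    { toFun := fun y => χ.comp ((tmulHom k e X Y).flip y)
      map_add' := fun y y' => by rw [map_add]; exact AddMonoidHom.comp_add _ _ _
      map_smul' := fun a y => Character.ext fun x => congrArg χ (smul_tmul k e X Y a x y).symm }

/-- The character of `X ⊗_A Y` given by a map from `Y` to the characters of `X`. -/
def uncurry {X : ModuleCat.{w} B} {Y : ModuleCat.{w} A}
    (β : Y ⟶ ModuleCat.of A (Character k e X)) : obj k e X Y →+ AddCircle (1 : ℚ) :=
  lift (AddMonoidHom.flip (β.hom.toAddMonoidHom : Y →+ (X →+ AddCircle (1 : ℚ))))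
    fun a x y => (DFunLike.congr_fun (β.hom.map_smul a y) x).symm

/-- The complex of characters of a complex of right `A`-modules; the parity of `n` determines
the sign of the differential. -/
def characterComplex (n : ℤ) (T : CochainComplex (ModuleCat.{w} B) ℤ) :
    CochainComplex (ModuleCat.{w} A) ℤ where
  X q := ModuleCat.of A (Character k e (T.X (-q)))
  d q q' := (q + n).negOnePow • characterMap k e (T.d (-q') (-q))
  shape q q' h := by
    rw [T.shape _ _ (by simp at h ⊢; lia)]
    refine (smul_eq_zero_iff_eq _).2 (ModuleCat.hom_ext (LinearMap.ext fun (φ : Character k e _) =>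
      Character.ext (k := k) (e := e) fun x => map_zero φ))
  d_comp_d' q q' q'' _ _ := by
    rw [Linear.units_smul_comp, Linear.comp_units_smul]
    refine (smul_eq_zero_iff_eq _).2 ((smul_eq_zero_iff_eq _).2 (ModuleCat.hom_ext
      (LinearMap.ext fun (φ : Character k e _) => Character.ext (k := k) (e := e) fun x => ?_)))
    exact (congrArg φ (congr($(T.d_comp_d (-q'') (-q') (-q)) x))).trans (map_zero φ)

lemma acyclic_characterComplex (n : ℤ) {T : CochainComplex (ModuleCat.{w} B) ℤ} (hT : T.Acyclic) :
    (characterComplex k e n T).Acyclic := by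
  intro q
  rw [HomologicalComplex.exactAt_iff' _ (q - 1) q (q + 1) (by simp) (by simp),
    ShortComplex.moduleCat_exact_iff]
  intro (φ : Character k e (T.X (-q))) hφ
  have hex := hT (-q)
  rw [HomologicalComplex.exactAt_iff' _ (-(q + 1)) (-q) (-(q - 1)) (by simp; lia)
    (by simp; lia)] at hex
  obtain ⟨ψ, hψ⟩ := exists_character_comp k e hex φ fun x =>
    (smul_eq_zero_iff_eq (q + n).negOnePow).1 (DFunLike.congr_fun (F := Character k e (T.X (-(q + 1)))) hφ x)
  refine ⟨(q - 1 + n).negOnePow • ψ, Character.ext (k := k) (e := e) fun x => ?_⟩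
  change (q - 1 + n).negOnePow • ((q - 1 + n).negOnePow • ψ ((T.d (-q) (-(q - 1))).hom x)) = φ x
  rw [smul_smul, Int.units_mul_self, one_smul]
  exact (hψ x).symm

end BalancedTensor

/-! ### Semi-projective complexes are semi-flat -/

namespace TateHomology

universe w

open CochainComplex HomComplex

variable (k : Type*) [CommRing k] {A B : Type*} [Ring A] [Algebra k A] [Ring B] [Algebra k B]

attribute [local instance] BalancedTensor.baseModule

variable (e : Aᵐᵒᵖ ≃ₐ[k] B)

section

variable (X : CochainComplex (ModuleCat.{w} B) ℤ) (Y : CochainComplex (ModuleCat.{w} A) ℤ)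

/-- The inclusion of a summand of the tensor product of two complexes, as an additive map. -/
def ιTensor (i j n : ℤ) (h : i + j = n) :
    BalancedTensor.obj k e (X.X i) (Y.X j) →+ (tensorComplex k e X Y).X n :=
  (ιMapBifunctor X Y (BalancedTensor.functor k e) i j n h).hom.toAddMonoidHom

lemma tensorComplex_d_tmul {i i' j j' n n' : ℤ} (h : i + j = n) (hi : i + 1 = i')
    (hj : j + 1 = j') (hn : n + 1 = n') (x : X.X i) (y : Y.X j) :
    ((tensorComplex k e X Y).d n n').hom
      (ιTensor k e X Y i j n h (BalancedTensor.tmul k e x y)) =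
      ιTensor k e X Y i' j n' (by lia) (BalancedTensor.tmul k e ((X.d i i').hom x) y) +
      i.negOnePow • ιTensor k e X Y i j' n' (by lia)
        (BalancedTensor.tmul k e x ((Y.d j j').hom y)) :=
  congr($(ιMapBifunctor_d X Y (BalancedTensor.functor k e) h hi hj hn)
    (BalancedTensor.tmul k e x y))

variable {k e X Y} in
lemma tensorComplex_addMonoidHom_ext {n : ℤ} {D : Type*} [AddCommGroup D]
    {p q : (tensorComplex k e X Y).X n →+ D}
    (h : ∀ i j (h : -i + j = n) x y, p (ιTensor k e X Y (-i) j n h (BalancedTensor.tmul k e x y)) =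
      q (ιTensor k e X Y (-i) j n h (BalancedTensor.tmul k e x y))) : p = q := by
  refine AddMonoidHom.ext fun z => ?_
  refine mapBifunctor_induction (p := fun z => p z = q z) z ?_ (fun z z' hz hz' => ?_)
    (fun i j hij z => ?_)
  · exact (map_zero p).trans (map_zero q).symm
  · exact (map_add p z z').trans ((congrArg₂ _ hz hz').trans (map_add q z z').symm)
  · obtain ⟨i, rfl⟩ : ∃ i', i = -i' := ⟨-i, by lia⟩
    exact DFunLike.congr_fun (BalancedTensor.addHom_ext
      (p := p.comp (ιTensor k e X Y (-i) j n hij)) (q := q.comp (ιTensor k e X Y (-i) j n hij))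
      (h i j hij)) z

lemma exists_addMonoidHom_tensorComplex {D : Type*} [AddCommGroup D] (n : ℤ)
    (g : ∀ i j, -i + j = n → (BalancedTensor.obj k e (X.X (-i)) (Y.X j) →+ D)) :
    ∃ ψ : (tensorComplex k e X Y).X n →+ D,
      ∀ i j (h : -i + j = n) x, ψ (ιTensor k e X Y (-i) j n h x) = g i j h x :=
  exists_addMonoidHom_mapBifunctor_neg X Y (BalancedTensor.functor k e) n g

end

/-- Semi-projective complexes are semi-flat: tensoring with them preserves acyclicity. -/
lemma IsSemiProjective.acyclic_tensorComplex {P : CochainComplex (ModuleCat.{w} A) ℤ}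
    (hP : IsSemiProjective P) {T : CochainComplex (ModuleCat.{w} B) ℤ} (hT : T.Acyclic) :
    (tensorComplex k e T P).Acyclic := by
  intro n
  rw [HomologicalComplex.exactAt_iff' _ (n - 1) n (n + 1) (by simp) (by simp),
    ShortComplex.moduleCat_exact_iff]
  intro (z : (tensorComplex k e T P).X n)
    (hz : ((tensorComplex k e T P).d n (n + 1)).hom z = 0)
  -- A cycle `z` that is not a boundary is detected by a character `χ` that kills all boundaries.
  by_contra hne
  let S : Submodule k ((tensorComplex k e T P).X n) :=
    ((tensorComplex k e T P).d (n - 1) n).hom.range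
  have hzS : S.mkQ z ≠ 0 := fun h => hne ((Submodule.Quotient.mk_eq_zero S).1 h)
  obtain ⟨χ₀, hχ₀⟩ := CharacterModule.exists_character_apply_ne_zero_of_ne_zero hzS
  let χ : (tensorComplex k e T P).X n →+ AddCircle (1 : ℚ) :=
    AddMonoidHom.comp χ₀ S.mkQ.toAddMonoidHom
  have hχ (y) : χ (((tensorComplex k e T P).d (n - 1) n).hom y) = 0 :=
    (congrArg χ₀ ((Submodule.Quotient.mk_eq_zero S).2 ⟨y, rfl⟩)).trans (map_zero χ₀)
  let Y := BalancedTensor.characterComplex k e n T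
  -- By tensor-hom adjunction `χ` becomes a cochain from `P` to the characters of `T`. That `χ`
  -- kills boundaries makes it a cocycle, with the signs of `Y` chosen for this.
  let α : Cochain P Y (-n) := Cochain.mk fun p q hpq =>
    BalancedTensor.curry k e (χ.comp (ιTensor k e T P (-q) p n (by lia)))
  have hα : δ (-n) (-n + 1) α = 0 := by
    refine Cochain.ext _ _ fun p q hpq => ?_
    rw [δ_v (-n) (-n + 1) rfl α p q hpq (q - 1) (p + 1) rfl rfl]
    refine BalancedTensor.hom_character_ext (k := k) (e := e) (X := T.X (-q))
      (Y := P.X p) fun y x => ?_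
    change (q - 1 + n).negOnePow • χ (ιTensor k e T P (-(q - 1)) p n (by lia)
        (BalancedTensor.tmul k e ((T.d (-q) (-(q - 1))).hom x) y)) +
      (-n + 1).negOnePow • χ (ιTensor k e T P (-q) (p + 1) n (by lia)
        (BalancedTensor.tmul k e x ((P.d p (p + 1)).hom y))) = 0
    have h₁ := hχ (ιTensor k e T P (-q) p (n - 1) (by lia) (BalancedTensor.tmul k e x y))
    rw [tensorComplex_d_tmul k e T P (i' := -(q - 1)) (j' := p + 1) (by lia) (by lia) rfl
      (by lia), map_add, Units.smul_def, map_zsmul, ← Units.smul_def] at h₁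
    have h₂ := congrArg ((q - 1 + n).negOnePow • ·) h₁
    simp only [smul_add, smul_smul, smul_zero, ← Int.negOnePow_add] at h₂
    rwa [show q - 1 + n + -q = -n + 1 + 2 * (n - 1) by ring, Int.negOnePow_add (-n + 1),
      Int.negOnePow_even _ (even_two_mul _), mul_one] at h₂
  -- Characters of the acyclic `T` form an acyclic complex, so semi-projectivity makes `α` a
  -- coboundary.
  obtain ⟨β, hβ⟩ : ∃ β : Cochain P Y (-n - 1), δ (-n - 1) (-n) β = α := by
    have hex := hP.acyclic_hom Y (BalancedTensor.acyclic_characterComplex k e n hT) (-n)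
    rw [HomologicalComplex.exactAt_iff' _ (-n - 1) (-n) (-n + 1) (by simp) (by simp),
      ShortComplex.ab_exact_iff] at hex
    exact hex α hα
  let b (j q : ℤ) (h : -q + j = n + 1) : P.X j ⟶
      ModuleCat.of A (BalancedTensor.Character k e (T.X (-q))) := β.v j q (by omega)
  -- Uncurrying `β` gives `ψ` with `ψ ∘ d = χ`, so `χ z = ψ (d z) = 0`, a contradiction. The sign
  -- `(j - 1).negOnePow` converts the differential of the Hom complex into that of the tensor
  -- product.
  obtain ⟨ψ, hψ⟩ := exists_addMonoidHom_tensorComplex k e T P (n + 1)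
    fun q j h => (j - 1).negOnePow • BalancedTensor.uncurry k e (b j q h)
  have hψd : (ψ.comp ((tensorComplex k e T P).d n (n + 1)).hom.toAddMonoidHom) = χ := by
    refine tensorComplex_addMonoidHom_ext fun q j h x y => ?_
    have hb : (q - 1 + n).negOnePow • ((b j (q - 1) (by omega)).hom y :
          BalancedTensor.Character k e (T.X (-(q - 1)))) ((T.d (-q) (-(q - 1))).hom x) +
        (-n).negOnePow • ((b (j + 1) q (by omega)).hom ((P.d j (j + 1)).hom y) :
          BalancedTensor.Character k e (T.X (-q))) x =
        χ (ιTensor k e T P (-q) j n h (BalancedTensor.tmul k e x y)) := by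
      have h₁ := Cochain.congr_v hβ j q (by omega)
      rw [δ_v (-n - 1) (-n) (by omega) β j q (by omega) (q - 1) (j + 1) rfl rfl] at h₁
      exact DFunLike.congr_fun (F := BalancedTensor.Character k e (T.X (-q))) congr($h₁ y) x
    rw [← hb]
    refine (congrArg ψ (tensorComplex_d_tmul k e T P (i' := -(q - 1)) (j' := j + 1) h
      (by omega) rfl rfl x y)).trans ?_
    rw [map_add, Units.smul_def, map_zsmul, ← Units.smul_def, hψ, hψ]
    change (j - 1).negOnePow • ((b j (q - 1) (by omega)).hom y :
          BalancedTensor.Character k e (T.X (-(q - 1)))) ((T.d (-q) (-(q - 1))).hom x) +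
        (-q).negOnePow • ((j + 1 - 1).negOnePow • ((b (j + 1) q (by omega)).hom
          ((P.d j (j + 1)).hom y) : BalancedTensor.Character k e (T.X (-q))) x) = _
    rw [smul_smul, ← Int.negOnePow_add, show j - 1 = q - 1 + n by omega,
      show -q + (j + 1 - 1) = -n + 2 * n by omega, Int.negOnePow_add (-n),
      Int.negOnePow_even _ (even_two_mul _), mul_one]
  exact hχ₀ ((DFunLike.congr_fun hψd z).symm.trans ((congrArg ψ hz).trans (map_zero ψ)))

end TateHomology

/-! ### Reduction of the coefficients to a single module -/

namespace CochainComplex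

section

variable {C : Type*} [Category* C] [Abelian C] {S : ShortComplex (CochainComplex C ℤ)}

/-- A short exact sequence of complexes splits in every degree in which one of the outer complexes
vanishes. -/
lemma nonempty_splitting_of_isZero (hS : S.ShortExact) (j : ℤ)
    (h : IsZero (S.X₁.X j) ∨ IsZero (S.X₃.X j)) :
    Nonempty (S.map (HomologicalComplex.eval _ _ j)).Splitting := by
  have hj : (S.map (HomologicalComplex.eval C (ComplexShape.up ℤ) j)).ShortExact :=
    hS.map_of_exact _
  obtain h | h := h
  · exact ⟨.ofIsZeroOfIsIso _ h (hj.isIso_g_iff.2 h)⟩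
  · exact ⟨.ofIsIsoOfIsZero _ (hj.isIso_f_iff.2 h) h⟩

end

end CochainComplex

namespace TateHomology

universe w

open CochainComplex

variable (k : Type*) [CommRing k] {A B : Type*} [Ring A] [Algebra k A] [Ring B] [Algebra k B]
  (e : Aᵐᵒᵖ ≃ₐ[k] B)

/-- The complex `T ⊗ G` for a module `G`. -/
abbrev tensorModule (T : CochainComplex (ModuleCat.{w} B) ℤ) (G : ModuleCat.{w} A) :
    CochainComplex (ModuleCat.{w} k) ℤ :=
  (((BalancedTensor.functor k e).flip.obj G).mapHomologicalComplex (.up ℤ)).obj T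

lemma acyclic_tensorModule {T : CochainComplex (ModuleCat.{w} B) ℤ} (hT : T.Acyclic)
    (G : ModuleCat.{w} A) [Module.Projective A G] : (tensorModule k e T G).Acyclic := fun i =>
  have := BalancedTensor.preservesHomology_flip k e G
  (hT i).map ((BalancedTensor.functor k e).flip.obj G)

/-- Each `T.X i ⊗ Q` is exact because `T.X i` is projective, and in total degree `n` the bound on
`Q` forces `i ≤ n - b`. -/
lemma acyclic_tensorComplex_of_isZero_lt {T : CochainComplex (ModuleCat.{w} B) ℤ}
    {Q : CochainComplex (ModuleCat.{w} A) ℤ} (hT : ∀ i, Module.Projective B (T.X i))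
    (hQ : Q.Acyclic) (b : ℤ) (hb : ∀ j < b, IsZero (Q.X j)) : (tensorComplex k e T Q).Acyclic := by
  refine acyclic_mapBifunctor T Q (BalancedTensor.functor k e) (fun i j => ?_) fun n =>
    ⟨n - b, fun i j h hi => Functor.map_isZero _ (hb j (by lia))⟩
  have := hT i
  exact (hQ j).map ((BalancedTensor.functor k e).obj (T.X i))

lemma acyclic_tensorComplex_of_isZero_gt {T : CochainComplex (ModuleCat.{w} B) ℤ}
    {V : CochainComplex (ModuleCat.{w} A) ℤ} (hT : T.Acyclic)
    (hV : ∀ j, Module.Projective A (V.X j)) (b : ℤ) (hb : ∀ j, b < j → IsZero (V.X j)) :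
    (tensorComplex k e T V).Acyclic := by
  refine acyclic_mapBifunctor_of_flip T V (BalancedTensor.functor k e) (fun j => ?_) fun n =>
    ⟨b, fun i j h hj => Functor.map_isZero _ (hb j hj)⟩
  have := hV j
  exact acyclic_tensorModule k e hT (V.X j)

/-- The tensor product with `T` as a functor of complexes. -/
abbrev tensorFunctor (T : CochainComplex (ModuleCat.{w} B) ℤ) :
    CochainComplex (ModuleCat.{w} A) ℤ ⥤ CochainComplex (ModuleCat.{w} k) ℤ :=
  (BalancedTensor.functor.{w} k e).map₂CochainComplex.obj T

lemma shortExact_tensorFunctor (T : CochainComplex (ModuleCat.{w} B) ℤ)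
    {S : ShortComplex (CochainComplex (ModuleCat.{w} A) ℤ)} (hS : S.ShortExact)
    (h : ∀ j, IsZero (S.X₁.X j) ∨ IsZero (S.X₃.X j)) :
    (S.map (tensorFunctor k e T)).ShortExact :=
  shortExact_map₂CochainComplex T _ fun j => (nonempty_splitting_of_isZero hS j (h j)).some

/-- Tensoring with a complex of projective modules preserves quasi-isomorphisms between complexes
which vanish in low degrees. -/
lemma nonempty_homology_iso_of_quasiIso {T : CochainComplex (ModuleCat.{w} B) ℤ}
    (hT : ∀ i, Module.Projective B (T.X i)) {K L : CochainComplex (ModuleCat.{w} A) ℤ} (f : K ⟶ L)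
    [QuasiIso f] (b : ℤ) (hK : ∀ j < b, IsZero (K.X j)) (hL : ∀ j < b, IsZero (L.X j)) (n : ℤ) :
    Nonempty ((tensorComplex k e T K).homology n ≅ (tensorComplex k e T L).homology n) := by
  have hS := shortExact_map₂CochainComplex T (BalancedTensor.functor k e) (mappingConeSplitting f)
  have hc : (tensorComplex k e T (mappingCone f)).Acyclic :=
    -- The bound drops to `b - 1` because the cone in degree `j` contains `K.X (j + 1)`.
    acyclic_tensorComplex_of_isZero_lt k e hT (acyclic_mappingCone f) (b - 1) fun j hj =>
      (mappingCone.isZero_X_iff f j).2 ⟨hK _ (by lia), hL _ (by lia)⟩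
  obtain ⟨φ⟩ := nonempty_homology_iso_of_acyclic_X₂ hS hc (n - 1) n (by lia)
  let ψ : (tensorComplex k e T (K⟦(1 : ℤ)⟧)).homology (n - 1) ≅
      ((tensorComplex k e T K)⟦(1 : ℤ)⟧).homology (n - 1) :=
    (HomologicalComplex.homologyFunctor _ _ (n - 1)).mapIso
      (mapBifunctorShift₂Iso T K (BalancedTensor.functor k e) 1)
  exact ⟨((ShiftSequence.shiftIso _ 1 (n - 1) n (by lia)).app _).symm ≪≫ ψ.symm ≪≫ φ⟩

section

variable {T : CochainComplex (ModuleCat.{w} B) ℤ} (P : CochainComplex (ModuleCat.{w} A) ℤ) (c : ℤ)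

/-- The subcomplex of `P` which agrees with `P` in the degrees `> c` and vanishes in the other
degrees. -/
def brutalTruncation : CochainComplex (ModuleCat.{w} A) ℤ where
  X j := ModuleCat.of A ((if c < j then ⊤ else ⊥ : Submodule A (P.X j)))
  d i j := ModuleCat.ofHom ((P.d i j).hom.restrict fun x hx => by
    by_cases hi : c < i
    · by_cases hij : i + 1 = j
      · rw [if_pos (by lia)]
        trivial
      · rw [P.shape i j hij]
        exact Submodule.zero_mem _
    · rw [if_neg hi, Submodule.mem_bot] at hx
      rw [hx, map_zero]
      exact Submodule.zero_mem _)
  shape i j hij := by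
    ext x
    exact congr($(P.shape i j hij) x.1)
  d_comp_d' i j l _ _ := by
    ext x
    exact congr($(P.d_comp_d i j l) x.1)

/-- The inclusion of the brutal truncation. -/
def brutalTruncationι : brutalTruncation P c ⟶ P where
  f _ := ModuleCat.ofHom (Submodule.subtype _)
  comm' _ _ _ := rfl

lemma mono_brutalTruncationι_f (j : ℤ) : Mono ((brutalTruncationι P c).f j) :=
  (ModuleCat.mono_iff_injective _).2 Subtype.val_injective

lemma isIso_brutalTruncationι_f (j : ℤ) (hj : c < j) : IsIso ((brutalTruncationι P c).f j) := by
  have := mono_brutalTruncationι_f P c j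
  have : Epi ((brutalTruncationι P c).f j) := (ModuleCat.epi_iff_surjective _).2 fun x =>
    ⟨⟨x, by rw [if_pos hj]; trivial⟩, rfl⟩
  exact isIso_of_mono_of_epi _

lemma isZero_brutalTruncation_X (j : ℤ) (hj : ¬ c < j) : IsZero ((brutalTruncation P c).X j) := by
  refine @ModuleCat.isZero_of_subsingleton _ _ _ ⟨fun x y => Subtype.ext ?_⟩
  have h (x : (brutalTruncation P c).X j) : x.1 = 0 := by
    have hx : x.1 ∈ (if c < j then ⊤ else ⊥ : Submodule A (P.X j)) := x.2
    simpa only [if_neg hj, Submodule.mem_bot] using hx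
  rw [h, h]

instance : Mono (brutalTruncationι P c) :=
  have := mono_brutalTruncationι_f P c
  HomologicalComplex.mono_of_mono_f _ this

end

end TateHomology

namespace CochainComplex

variable {C : Type*} [Category* C] [Abelian C]

/-- The inequality is strict: in degree `c` the truncation is a module of opcycles. -/
lemma isIso_πTruncGE_f (K : CochainComplex C ℤ) (c j : ℤ) (hj : c < j) :
    IsIso ((K.πTruncGE c).f j) := by
  have h : (ComplexShape.embeddingUpIntGE c).f (j - c).toNat = j := by
    change c + ((j - c).toNat : ℤ) = j
    lia
  refine ((ComplexShape.embeddingUpIntGE c).isIso_liftExtend_f_iff _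
    (K.restrictionToTruncGE'_hasLift _) h).2 ?_
  refine K.isIso_restrictionToTruncGE' (ComplexShape.embeddingUpIntGE c) _ fun h' => ?_
  rw [ComplexShape.boundaryGE_embeddingUpIntGE_iff] at h'
  lia

end CochainComplex

namespace TateHomology

universe w

open CochainComplex

variable (k : Type*) [CommRing k] {A B : Type*} [Ring A] [Algebra k A] [Ring B] [Algebra k B]
  (e : Aᵐᵒᵖ ≃ₐ[k] B)

variable {T : CochainComplex (ModuleCat.{w} B) ℤ} {P N : CochainComplex (ModuleCat.{w} A) ℤ}

lemma projective_of_iso {X Y : ModuleCat.{w} A} (i : X ≅ Y) [Module.Projective A X] :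
    Module.Projective A Y :=
  .of_equiv i.toLinearEquiv

/-- In the degreewise split sequence `P^{> c} ⟶ P ⟶ P^{≤ c}` the middle term becomes acyclic since
`P` is semi-flat, and the last since it consists of projectives and vanishes above `c`. -/
lemma acyclic_tensorComplex_brutalTruncation (hT : T.Acyclic) (hP : IsSemiProjective P) (c : ℤ) :
    (tensorComplex k e T (brutalTruncation P c)).Acyclic := by
  let S := ShortComplex.mk (brutalTruncationι P c) (cokernel.π _) (cokernel.condition _)
  have hS : S.ShortExact := { exact := S.exact_of_g_is_cokernel (cokernelIsCokernel _) }
  have hSj (j : ℤ) : (S.map (HomologicalComplex.eval _ (ComplexShape.up ℤ) j)).ShortExact :=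
    hS.map_of_exact _
  have hV (j : ℤ) (hj : c < j) : IsZero (S.X₃.X j) :=
    (hSj j).isIso_f_iff.1 (isIso_brutalTruncationι_f P c j hj)
  have h (j : ℤ) : IsZero (S.X₁.X j) ∨ IsZero (S.X₃.X j) := by
    by_cases hj : c < j
    · exact .inr (hV j hj)
    · exact .inl (isZero_brutalTruncation_X P c j hj)
  refine acyclic_X₁_of_shortExact (shortExact_tensorFunctor k e T hS h)
    (hP.acyclic_tensorComplex k e hT)
    (acyclic_tensorComplex_of_isZero_gt k e hT (V := S.X₃) (fun j => ?_) c hV)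
  by_cases hj : c < j
  · have := ModuleCat.subsingleton_of_isZero (hV j hj)
    infer_instance
  · have := hP.projective j
    have : IsIso (S.g.f j) := (hSj j).isIso_g_iff.2 (isZero_brutalTruncation_X P c j hj)
    exact projective_of_iso (asIso (S.g.f j))

/-- The subcomplex `P^{> c}` of the truncation contributes nothing after tensoring with `T`, and the
quotient is `P.opcycles c` placed in degree `c`. -/
lemma nonempty_homology_truncGE_iso (hT : T.Acyclic) (hP : IsSemiProjective P) (c m n : ℤ)
    (h : m + c = n) :
    Nonempty ((tensorComplex k e T (P.truncGE c)).homology n ≅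
      (tensorModule k e T (P.opcycles c)).homology m) := by
  let u : brutalTruncation P c ⟶ P.truncGE c := brutalTruncationι P c ≫ P.πTruncGE c
  have hu (j : ℤ) (hj : c < j) : IsIso (u.f j) :=
    have := isIso_brutalTruncationι_f P c j hj
    have := isIso_πTruncGE_f P c j hj
    inferInstanceAs (IsIso (_ ≫ _))
  have hmono : Mono u := HomologicalComplex.mono_of_mono_f _ fun j => by
    by_cases hj : c < j
    · have := hu j hj
      infer_instance
    · exact (isZero_brutalTruncation_X P c j hj).mono _
  let S := ShortComplex.mk u (cokernel.π _) (cokernel.condition _)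
  have hS : S.ShortExact := { exact := S.exact_of_g_is_cokernel (cokernelIsCokernel _) }
  have hSj (j : ℤ) : (S.map (HomologicalComplex.eval _ (ComplexShape.up ℤ) j)).ShortExact :=
    hS.map_of_exact _
  have hV (j : ℤ) (hj : c < j) : IsZero (S.X₃.X j) := (hSj j).isIso_f_iff.1 (hu j hj)
  have h' (j : ℤ) : IsZero (S.X₁.X j) ∨ IsZero (S.X₃.X j) := by
    by_cases hj : c < j
    · exact .inr (hV j hj)
    · exact .inl (isZero_brutalTruncation_X P c j hj)
  have hW (j : ℤ) (hj : j ≠ c) : IsZero (S.X₃.X j) := by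
    obtain hj | hj := hj.lt_or_gt
    · have hz : IsZero ((P.truncGE c).X j) := isZero_of_isStrictlyGE _ c j
      have : Epi (S.g.f j) := (hSj j).epi_g
      exact hz.of_epi (S.g.f j)
    · exact hV j hj
  have : IsIso (S.g.f c) := (hSj c).isIso_g_iff.2 (isZero_brutalTruncation_X P c c (by simp))
  obtain ⟨φ⟩ := nonempty_homology_iso_of_acyclic_X₁ (shortExact_tensorFunctor k e T hS h')
    (acyclic_tensorComplex_brutalTruncation k e hT hP c) n
  obtain ⟨ψ⟩ := nonempty_mapBifunctor_homology_iso T (BalancedTensor.functor k e) hW m n h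
  let i : S.X₃.X c ≅ P.opcycles c := (asIso (S.g.f c)).symm ≪≫ P.truncGEXIsoOpcycles c
  exact ⟨φ ≪≫ ψ ≪≫ (HomologicalComplex.homologyFunctor _ _ m).mapIso
    ((NatIso.mapHomologicalComplex ((BalancedTensor.functor k e).flip.mapIso i) _).app T)⟩

/-- `P` may be nonzero in arbitrarily low degrees, so `π` itself cannot be tensored with `T`. Its
truncation can, and `N` is its own truncation at `c`. -/
lemma nonempty_homology_tensorComplex_iso (hT : T.Acyclic) (hT' : ∀ i, Module.Projective B (T.X i))
    (hP : IsSemiProjective P) (π : P ⟶ N) [QuasiIso π] (c m n : ℤ)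
    (hN : ∀ j < c, IsZero (N.X j)) (h : m + c = n) :
    Nonempty ((tensorComplex k e T N).homology n ≅
      (tensorModule k e T (P.opcycles c)).homology m) := by
  have : N.IsStrictlyGE c := (isStrictlyGE_iff _ _).2 hN
  have : QuasiIso (truncGEMap π c) := (quasiIso_truncGEMap_iff π c).2 fun _ _ => inferInstance
  obtain ⟨φ⟩ := nonempty_homology_iso_of_quasiIso k e hT' (truncGEMap π c ≫ inv (N.πTruncGE c)) c
    (fun j hj => isZero_of_isStrictlyGE _ c j) hN n
  obtain ⟨ψ⟩ := nonempty_homology_truncGE_iso k e hT hP c m n h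
  exact ⟨φ.symm ≪≫ ψ⟩

end TateHomology

/-! ### Opcycles and homology -/

namespace CochainComplex

variable {C : Type*} [Category* C] [Abelian C]

lemma exact_pOpcycles (K : CochainComplex C ℤ) (p q : ℤ) (h : p + 1 = q) :
    (ShortComplex.mk (K.d p q) (K.pOpcycles q) (by simp)).Exact :=
  ShortComplex.exact_of_g_is_cokernel _ (K.opcyclesIsCokernel p q (by simp [← h]))

/-- The short complex `Z ⟶ K.X q ⟶ K.opcycles q`, where `Z` consists of the opcycles in degree
`q - 1`. -/
def opcyclesShortComplex (K : CochainComplex C ℤ) (p q : ℤ) : ShortComplex C :=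
  ShortComplex.mk (K.fromOpcycles p q) (K.pOpcycles q) (by
    rw [← cancel_epi (K.pOpcycles p)]
    simp)

/-- The kernel of `K.fromOpcycles p q` is the homology in degree `p`, so acyclicity gives
injectivity on the left. -/
lemma shortExact_opcyclesShortComplex {K : CochainComplex C ℤ} (hK : K.Acyclic) (p q : ℤ)
    (h : p + 1 = q) : (opcyclesShortComplex K p q).ShortExact where
  exact := by
    let φ : ShortComplex.mk (K.d p q) (K.pOpcycles q) (by simp) ⟶ opcyclesShortComplex K p q :=
      { τ₁ := K.pOpcycles p, τ₂ := 𝟙 _, τ₃ := 𝟙 _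
        comm₁₂ := (K.p_fromOpcycles p q).trans (Category.comp_id _).symm
        comm₂₃ := (Category.id_comp _).trans (Category.comp_id _).symm }
    have : Epi φ.τ₁ := inferInstanceAs (Epi (K.pOpcycles p))
    have : IsIso φ.τ₂ := inferInstanceAs (IsIso (𝟙 _))
    have : Mono φ.τ₃ := inferInstanceAs (Mono (𝟙 _))
    exact (ShortComplex.exact_iff_of_epi_of_isIso_of_mono φ).1 (exact_pOpcycles K p q h)
  mono_f := by
    let S := ShortComplex.mk (K.homologyι p) (K.fromOpcycles p q) (by simp)
    have hS : S.Exact := S.exact_of_f_is_kernel (K.homologyIsKernel p q (by simp [← h]))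
    exact hS.mono_g ((hK p).isZero_homology.eq_of_src _ _)
  epi_g := inferInstanceAs (Epi (K.pOpcycles q))

lemma isIso_opcyclesMap {K L : CochainComplex C ℤ} (f : K ⟶ L) (p q : ℤ) (h : p + 1 = q)
    [IsIso (f.f p)] [IsIso (f.f q)] : IsIso (HomologicalComplex.opcyclesMap f q) := by
  obtain rfl : (ComplexShape.up ℤ).prev q = p := by simp [← h]
  exact ShortComplex.isIso_opcyclesMap_of_isIso_of_epi'
    ((HomologicalComplex.shortComplexFunctor C (.up ℤ) q).map f) ‹_› (inferInstanceAs (Epi (f.f _)))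

section

variable {D : Type*} [Category* D] [Abelian D] (F : C ⥤ D) [F.PreservesZeroMorphisms]

/-- Homology is the kernel of the map from opcycles to the next term. The assumed right exactness at
`q` is what is needed for `F` to commute with opcycles there. -/
lemma nonempty_homology_mapHomologicalComplex_iso_kernel (K : CochainComplex C ℤ) (p q r : ℤ)
    (hpq : p + 1 = q) (hqr : q + 1 = r)
    (hex : ((ShortComplex.mk (K.d p q) (K.pOpcycles q) (by simp)).map F).Exact)
    [hepi : Epi (F.map (K.pOpcycles q))] :
    Nonempty (((F.mapHomologicalComplex (.up ℤ)).obj K).homology q ≅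
      kernel (F.map (K.fromOpcycles q r))) := by
  let L := (F.mapHomologicalComplex (.up ℤ)).obj K
  have : Epi ((ShortComplex.mk (K.d p q) (K.pOpcycles q) (by simp)).map F).g := hepi
  let α : L.opcycles q ≅ F.obj (K.opcycles q) :=
    (L.opcyclesIsCokernel p q (by simp [← hpq])).coconePointUniqueUpToIso hex.gIsCokernel
  have hα : L.pOpcycles q ≫ α.hom = F.map (K.pOpcycles q) :=
    (L.opcyclesIsCokernel p q (by simp [← hpq])).comp_coconePointUniqueUpToIso_hom
      hex.gIsCokernel WalkingParallelPair.one
  have hα' : L.fromOpcycles q r = α.hom ≫ F.map (K.fromOpcycles q r) :=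
    (cancel_epi (L.pOpcycles q)).1 <| (L.p_fromOpcycles q r).trans <|
      (congrArg F.map (K.p_fromOpcycles q r).symm).trans <| (F.map_comp _ _).trans <|
      (congrArg (· ≫ F.map (K.fromOpcycles q r)) hα.symm).trans (Category.assoc _ _ _)
  let β : L.homology q ≅ kernel (L.fromOpcycles q r) :=
    (L.homologyIsKernel q r (by simp [← hqr])).conePointUniqueUpToIso (limit.isLimit _)
  exact ⟨β ≪≫ kernel.mapIso _ _ α (Iso.refl (F.obj (K.X r)))
    ((Category.comp_id _).trans hα')⟩

end

end CochainComplex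

/-! ### Dimension shifting, symmetry and the conclusion -/

namespace TateHomology

universe w

open CochainComplex

variable (k : Type*) [CommRing k] {A B : Type*} [Ring A] [Algebra k A] [Ring B] [Algebra k B]
  (e : Aᵐᵒᵖ ≃ₐ[k] B)

section

variable {T : CochainComplex (ModuleCat.{w} B) ℤ} {T' : CochainComplex (ModuleCat.{w} A) ℤ}

/-- Dimension shifting along `C'^c ⟶ T'^{c+1} ⟶ C'^{c+1}`: the projectives of `T` keep it exact, and
`T ⊗ T'^{c+1}` is acyclic because `T'^{c+1}` is projective. -/
lemma nonempty_homology_tensorModule_succ_iso (hT : T.Acyclic)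
    (hTp : ∀ i, Module.Projective B (T.X i)) (hT' : T'.Acyclic)
    (hTp' : ∀ i, Module.Projective A (T'.X i)) (n c : ℤ) :
    Nonempty ((tensorModule k e T (T'.opcycles (c + 1))).homology n ≅
      (tensorModule k e T (T'.opcycles c)).homology (n + 1)) := by
  let S := opcyclesShortComplex T' c (c + 1)
  have hS : S.ShortExact := shortExact_opcyclesShortComplex hT' c (c + 1) rfl
  let F := (BalancedTensor.functor k e).flip
  let S' : ShortComplex (CochainComplex (ModuleCat.{w} k) ℤ) :=
    ShortComplex.mk ((NatTrans.mapHomologicalComplex (F.map S.f) (.up ℤ)).app T)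
      ((NatTrans.mapHomologicalComplex (F.map S.g) (.up ℤ)).app T) (by
        ext i : 1
        have := congrArg ((BalancedTensor.functor k e).obj (T.X i)).map S.zero
        rw [Functor.map_comp, Functor.map_zero] at this
        exact this)
  have hS' : S'.ShortExact := by
    refine HomologicalComplex.shortExact_of_degreewise_shortExact _ fun i => ?_
    have := hTp i
    have := ((BalancedTensor.functor k e).obj (T.X i)).preservesFiniteLimits_of_preservesHomology
    have := ((BalancedTensor.functor k e).obj (T.X i)).preservesFiniteColimits_of_preservesHomology
    exact hS.map_of_exact ((BalancedTensor.functor k e).obj (T.X i))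
  have := hTp' (c + 1)
  exact nonempty_homology_iso_of_acyclic_X₂ hS'
    (acyclic_tensorModule k e hT (T'.X (c + 1))) n (n + 1) rfl

lemma nonempty_homology_tensorModule_iso (hT : T.Acyclic)
    (hTp : ∀ i, Module.Projective B (T.X i)) (hT' : T'.Acyclic)
    (hTp' : ∀ i, Module.Projective A (T'.X i)) (n n' c c' : ℤ) (h : n + c = n' + c') :
    Nonempty ((tensorModule k e T (T'.opcycles c)).homology n ≅
      (tensorModule k e T (T'.opcycles c')).homology n') := by
  wlog hc : c' ≤ c generalizing n n' c c'
  · obtain ⟨φ⟩ := this n' n c' c h.symm (by lia)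
    exact ⟨φ.symm⟩
  obtain ⟨d, rfl⟩ := Int.le.dest hc
  induction d generalizing n with
  | zero =>
    obtain rfl : n = n' := by lia
    exact ⟨eqToIso (by simp)⟩
  | succ d ih =>
    obtain ⟨φ⟩ := nonempty_homology_tensorModule_succ_iso k e hT hTp hT' hTp' n (c' + d)
    obtain ⟨ψ⟩ := ih (n + 1) (by push_cast at h; lia) (by lia)
    rw [show c' + ((d + 1 : ℕ) : ℤ) = c' + d + 1 by push_cast; ring]
    exact ⟨φ ≪≫ ψ⟩

/-- The map `C ⊗ C' ⟶ T^{p+1} ⊗ T'^{q+1}` where `C` and `C'` are the cokernels of the differentials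
into `T^p` and `T'^q`. -/
def opcyclesTensorMap (T : CochainComplex (ModuleCat.{w} B) ℤ)
    (T' : CochainComplex (ModuleCat.{w} A) ℤ) (p q : ℤ) :
    BalancedTensor.obj k e (T.opcycles p) (T'.opcycles q) ⟶
      BalancedTensor.obj k e (T.X (p + 1)) (T'.X (q + 1)) :=
  BalancedTensor.map k e (T.fromOpcycles p (p + 1)) (T'.fromOpcycles q (q + 1))

/-- Right exactness gives the kernel of `C^p ⊗ C'^q ⟶ T^{p+1} ⊗ C'^q`. As `T^{p+1}` is flat and
`C'^q` embeds in `T'^{q+1}`, enlarging the target does not change the kernel and makes the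
description symmetric. -/
lemma nonempty_homology_iso_kernel (hTp : ∀ i, Module.Projective B (T.X i)) (hT' : T'.Acyclic)
    (p q : ℤ) : Nonempty ((tensorModule k e T (T'.opcycles q)).homology p ≅
      kernel (opcyclesTensorMap k e T T' p q)) := by
  obtain ⟨φ⟩ := nonempty_homology_mapHomologicalComplex_iso_kernel
    ((BalancedTensor.functor k e).flip.obj (T'.opcycles q)) T (p - 1) p (p + 1) (by lia) rfl
    (BalancedTensor.exact_map_flip_of_epi k e _ (exact_pOpcycles T (p - 1) p (by lia)))
  let G := (BalancedTensor.functor k e).obj (T.X (p + 1))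
  have := hTp (p + 1)
  have : G.PreservesHomology :=
    inferInstanceAs ((BalancedTensor.functor k e).obj (T.X (p + 1))).PreservesHomology
  have := G.preservesFiniteLimits_of_preservesHomology
  have : Mono (T'.fromOpcycles q (q + 1)) :=
    (shortExact_opcyclesShortComplex hT' q (q + 1) rfl).mono_f
  have : Mono (G.map (T'.fromOpcycles q (q + 1))) := inferInstance
  have hmap : opcyclesTensorMap k e T T' p q =
      ((BalancedTensor.functor k e).flip.obj (T'.opcycles q)).map (T.fromOpcycles p (p + 1)) ≫
        G.map (T'.fromOpcycles q (q + 1)) :=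
    BalancedTensor.hom_ext fun _ _ => rfl
  rw [hmap]
  exact ⟨φ ≪≫ (kernelCompMono _ (G.map (T'.fromOpcycles q (q + 1)))).symm⟩

lemma nonempty_homology_tensorModule_swap_iso (e' : Bᵐᵒᵖ ≃ₐ[k] A)
    (he : ∀ a : A, e' (MulOpposite.op (e (MulOpposite.op a))) = a) (hT : T.Acyclic)
    (hTp : ∀ i, Module.Projective B (T.X i)) (hT' : T'.Acyclic)
    (hTp' : ∀ i, Module.Projective A (T'.X i)) (p q : ℤ) :
    Nonempty ((tensorModule k e T (T'.opcycles q)).homology p ≅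
      (tensorModule k e' T' (T.opcycles p)).homology q) := by
  obtain ⟨φ⟩ := nonempty_homology_iso_kernel k e hTp hT' p q
  obtain ⟨ψ⟩ := nonempty_homology_iso_kernel k e' hTp' hT q p
  exact ⟨φ ≪≫ kernel.mapIso _ _ (BalancedTensor.swap k e e' he _ _)
    (BalancedTensor.swap k e e' he _ _) (BalancedTensor.hom_ext fun _ _ => rfl) ≪≫ ψ.symm⟩

end

/-- Tate homology of a bounded above complex, in terms of the cokernels of the differentials of a
complete projective resolution of that complex. -/
lemma exists_nonempty_homology_tensorComplex_iso {T : CochainComplex (ModuleCat.{w} B) ℤ}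
    (hT : T.Acyclic) (hTp : ∀ i, Module.Projective B (T.X i))
    {N : CochainComplex (ModuleCat.{w} A) ℤ} (hN : BoundedAbove N)
    (Y : CompleteProjectiveResolution N) (n : ℤ) : ∃ c m : ℤ, m + c = n ∧
      Nonempty ((tensorComplex k e T N).homology n ≅
        (tensorModule k e T (Y.T.opcycles c)).homology m) := by
  obtain ⟨s, hs⟩ := hN
  obtain ⟨l, hl⟩ := Y.isIso_τ
  have hs' (j : ℤ) (hj : j < -s) : IsZero (N.X j) := by simpa using hs (-j) (by lia)
  have hl' (j : ℤ) (hj : j ≤ -l) : IsIso (Y.τ.f j) := by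
    obtain ⟨j, rfl⟩ : ∃ j', j = -j' := ⟨-j, by simp⟩
    exact hl j (by lia)
  -- Below `-s` the complex `N` vanishes, and up to `-l` the map `τ` is invertible; the opcycles in
  -- degree `c` involve only the degrees `c - 1` and `c`.
  let c := min (-s) (-l)
  have := Y.quasiIso
  obtain ⟨φ⟩ := nonempty_homology_tensorComplex_iso k e hT hTp Y.semiProjective Y.π c (n - c) n
    (fun j hj => hs' j (by lia)) (by lia)
  have := hl' (c - 1) (by lia)
  have := hl' c (by lia)
  have := isIso_opcyclesMap Y.τ (c - 1) c (by lia)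
  let i := (asIso (HomologicalComplex.opcyclesMap Y.τ c)).symm
  exact ⟨c, n - c, by lia, ⟨φ ≪≫ (HomologicalComplex.homologyFunctor _ _ (n - c)).mapIso
    ((NatIso.mapHomologicalComplex ((BalancedTensor.functor k e).flip.mapIso i) _).app T)⟩⟩

/-- Balancedness of Tate homology, for a ring `A` and an algebra `B` identified with the opposite
algebra of `A`. -/
theorem nonempty_tateTor_iso (e' : Bᵐᵒᵖ ≃ₐ[k] A)
    (he : ∀ a : A, e' (MulOpposite.op (e (MulOpposite.op a))) = a)
    {M : CochainComplex (ModuleCat.{w} B) ℤ} {N : CochainComplex (ModuleCat.{w} A) ℤ}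
    (hM : BoundedAbove M) (hN : BoundedAbove N) (X : CompleteProjectiveResolution M)
    (Y : CompleteProjectiveResolution N) (i : ℤ) :
    Nonempty (tateTor k e X N i ≅ tateTor k e' Y M i) := by
  have hX := X.totallyAcyclic
  have hY := Y.totallyAcyclic
  obtain ⟨c, p, h, ⟨φ⟩⟩ := exists_nonempty_homology_tensorComplex_iso k e hX.acyclic
    hX.projective hN Y (-i)
  obtain ⟨c', p', h', ⟨φ'⟩⟩ := exists_nonempty_homology_tensorComplex_iso k e' hY.acyclic
    hY.projective hM X (-i)
  obtain ⟨ψ⟩ := nonempty_homology_tensorModule_swap_iso k e e' he hX.acyclic hX.projective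
    hY.acyclic hY.projective p c
  -- After the swap the homological degree is `c` and the opcycles sit in degree `p`. Both `c + p`
  -- and `p' + c'` equal `-i`, so dimension shifting joins the two sides.
  obtain ⟨χ⟩ := nonempty_homology_tensorModule_iso k e' hY.acyclic hY.projective hX.acyclic
    hX.projective c p' p c' (by lia)
  exact ⟨φ ≪≫ ψ ≪≫ χ ≪≫ φ'.symm⟩

end TateHomology

end

theorem mainTheorem3 (k : Type t) [CommRing k] (R : Type u) [Ring R] [Algebra k R]
    (M : CochainComplex (ModuleCat.{max u v} Rᵐᵒᵖ) ℤ) (N : CochainComplex (ModuleCat.{max u v} R) ℤ)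
    (hM : TateHomology.BoundedAbove M) (hN : TateHomology.BoundedAbove N)
    (hM' : TateHomology.gorensteinProjectiveDimension M < ⊤)
    (hN' : TateHomology.gorensteinProjectiveDimension N < ⊤) :
    ∀ (X : TateHomology.CompleteProjectiveResolution M)
      (Y : TateHomology.CompleteProjectiveResolution N) (i : ℤ),
      Nonempty (TateHomology.tateTor k (AlgEquiv.refl : Rᵐᵒᵖ ≃ₐ[k] Rᵐᵒᵖ) X N i ≅
        TateHomology.tateTor k (AlgEquiv.opOp k R).symm Y M i) :=
  fun X Y i => TateHomology.nonempty_tateTor_iso k _ _ (fun _ => rfl) hM hN X Y i
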